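/- **Data.** Let $\mathfrak h$ be a finite-dimensional complex vector space with a non-degenerate symmetric bilinear form, let $\alpha_1,\dots,\alpha_R\in\mathfrak h^*$ be linearly independent, let $H_i\in\mathfrak h$ correspond to $\alpha_i$ under the form, and let $b_{ij}=(\alpha_i,\alpha_j)$. Let $\mathfrak g$ be the complex Lie algebra generated by $E_i,F_i$ ($1\le i\le R$) and $\mathfrak h$ subject to $$[E_i,F_j]=\delta_{ij}H_i,\quad [h,E_i]=\alpha_i(h)E_i,\quad [h,F_i]=-\alpha_i(h)F_i,\quad [h,h']=0 ,$$ and $\mathfrak g=\mathfrak n\oplus\mathfrak h\oplus\mathfrak n_+$ its triangular decomposition, where $\mathfrak n$ and $\mathfrak n_+$ are generated by the $F_i$ and by the $E_i$. Let $\varphi:\mathfrak g\to\mathfrak g$ be the linear map with $\varphi(E_i)=F_i$, $\varphi(F_i)=E_i$, $\varphi|_{\mathfrak h}=\mathrm{id}$, $\varphi([x,y])=-[\varphi(x),\varphi(y)]$. Let $K$ be the unique invariant bilinear form on $\mathfrak g$ that extends the form of $\mathfrak h$, satisfies $K(E_i,F_j)=K(F_j,E_i)=\delta_{ij}$, vanishes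 on $\mathfrak n\times\mathfrak n$ and $\mathfrak n_+\times\mathfrak n_+$, and for which $\mathfrak h$ is orthogonal to $\mathfrak n\oplus\mathfrak n_+$. Put $S_{\mathfrak g}(x,y)=-K(\varphi(x),y)$; $\ker S_{\mathfrak g}$ is an ideal. Let $\sigma$ be a diagram automorphism of $\mathfrak g$: an automorphism with $\sigma E_i=E_{\sigma(i)}$, $\sigma F_i=F_{\sigma(i)}$, $\sigma H_i=H_{\sigma(i)}$ for a permutation $\sigma$ of $\{1,\dots,R\}$. Let $T\ge 1$ be an integer (for instance the order of $\sigma$) for which the $T$-th power of this permutation is the identity, and let $\omega\in\mathbb C$ be a primitive $T$-th root of unity. Let $\iota(1),\dots,\iota(r)$ represent the cycles of the permutation, once each, and let $T_i$ be the length of the cycle of $\iota(i)$. A word $F_{j_1}\cdots F_{j_m}$ in $U(\mathfrak n)$ has weight $\lambda=(\lambda_1,\dots,\lambda_r)$ if exactly $\lambda_i$ of the letters have index in the cycle of $\iota(i)$; $\mathfrak n_\lambda$ is the weight component of $\mathfrak n$, $\mathfrak n_{+,\lambda}=\varphi(\mathfrak n_\lambda)$, and a superscript $\sigma$ denotes fixed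 points. Let $\tilde{\mathfrak g}=\mathfrak g/\ker S_{\mathfrak g}$ and $\tilde{\mathfrak g}^\sigma=(\mathfrak g/\ker S_{\mathfrak g})^\sigma\cong\mathfrak g^\sigma/(\ker S_{\mathfrak g}\cap\mathfrak g^\sigma)$. **The form $\Omega$.** Fix a weight $\lambda\neq0$, put $m=\lambda_1+\dots+\lambda_r$, and divide $\{1,\dots,m\}$ into consecutive blocks of sizes $\lambda_1,\dots,\lambda_r$. Consider in $\mathbb C^m$ the arrangement $\mathcal A_\lambda$ of the hyperplanes $H^k_{pq}:\ t_p=\omega^kt_q$ ($1\le p<q\le m$, $k\in\mathbb Z/T$), with weights $$a(H^k_{pq})=(\alpha_{\iota(i)},\sigma^k\alpha_{\iota(j)})=b_{\iota(i),\sigma^k\iota(j)}\qquad(p\text{ in block }i,\ q\text{ in block }j).$$ For a full flag $L=(\mathbb C^m=L^0\supset L^1\supset\dots\supset L^m=\{0\})$ and hyperplanes $H_1,\dots,H_m$ of $\mathcal A_\lambda$, let $\langle L,H_1\wedge\dots\wedge H_m\rangle$ be the sign of the permutation $s$ with $L^i=H_{s(1)}\cap\dots\cap H_{s(i)}$ for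 all $1\le i\le m$ if there is one, and $0$ otherwise. The geometric form is $$G(L,L')=\sum_{\{H_1,\dots,H_m\}}\langle L,H_1\wedge\dots\wedge H_m\rangle\,\langle L',H_1\wedge\dots\wedge H_m\rangle\,a(H_1)\cdots a(H_m),$$ summed over the unordered $m$-tuples of hyperplanes of $\mathcal A_\lambda$ and extended bilinearly to formal combinations of flags. Let $\mathfrak a$ be the free Lie algebra on letters $f^k_p$ ($k\in\mathbb Z/T$, $1\le p\le m$), $\tau$ its automorphism $f^k_p\mapsto f^{k+1}_p$, and $\mathfrak a_{[1^m]}$ the span of the commutators in which every index $p$ occurs exactly once; write $\overline x=\sum_{k\in\mathbb Z/T}\tau^kx$. There is a linear map $\psi$ from $\{\overline x:x\in\mathfrak a_{[1^m]}\}$ to combinations of flags, modulo the kernel of $G$, determined as follows. For $\ell=[\cdots[[x_1,x_2],x_3],\cdots,x_m]$ with $x_a=f^{\kappa(a)}_{e(a)}$, $\psi(\overline\ell)$ is $\operatorname{sgn}\big(e(m),e(m-1),\dots,e(1)\big)$ times the flag with $$L^j=\{\omega^{\kappa(1)}t_{e(1)}=\dots=\omega^{\kappa(j+1)}t_{e(j+1)}\}\quad(0\le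 j<m),\qquad L^m=\{0\}.$$ Put $\mathrm{Geom}_0(\overline x,\overline y)=G(\psi(\overline x),\psi(\overline y))$. (Explicitly: a $\tau$-invariant $x\in\mathfrak a_{[1^m]}$ with expansion $x=\sum_uc_uu$ into words has $\psi(x)=\frac1{mT}\sum_uc_u\,\psi(\overline{\ell(u)})$, where $\ell(u)$ is the iterated commutator, as above, of the letters of $u$.) Let $\mathsf s$ be the symmetrization map: the algebra homomorphism sending $F_j$ to the sum of all $f^k_p$ with $\sigma^k(\iota(i))=j$, $i$ being the block of $p$, followed by the projection to the span of the words in which every index $p$ occurs exactly once. Let $|\Sigma\mathbb Z_\lambda|=\prod_i (T/T_i)^{\lambda_i}\lambda_i!$. Define the skew-symmetric bilinear form $\Omega:\mathfrak g^\sigma\times\mathfrak g^\sigma\to\mathbb C$ by $$\Omega(x,y)=-\Omega(y,x)=\frac1{|\Sigma\mathbb Z_\lambda|}\,\mathrm{Geom}_0\big(\mathsf s(\varphi(x)),\mathsf s(y)\big)\qquad(x\in\mathfrak n_{+,\lambda}^\sigma,\ y\in\mathfrak n^\sigma_\lambda,\ \lambda\ne0),$$ and by $0$ on all other pairs of components of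 the weight decomposition of $\mathfrak g^\sigma$. It is a cocycle that descends to $\tilde{\mathfrak g}^\sigma$. **Proposition.** If $\Omega$ is a coboundary, then $\Omega=0$. That is: if there is a linear map $\alpha:\tilde{\mathfrak g}^\sigma\to\mathbb C$ with $\Omega(x,y)=\alpha([\tilde x,\tilde y])$ for all $x,y\in\mathfrak g^\sigma$, where $\tilde x,\tilde y$ are the images of $x,y$ in $\tilde{\mathfrak g}^\sigma$, then $\Omega=0$. The same holds on $\mathfrak g^\sigma$: if there is a linear map $\alpha:\mathfrak g^\sigma\to\mathbb C$ with $\Omega(x,y)=\alpha([x,y])$ for all $x,y\in\mathfrak g^\sigma$, then $\Omega=0$. -/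

import Mathlib

noncomputable section

attribute [local instance 100] LieRing.ofAssociativeRing

namespace CyclotomicOmega

/-! ### Cartan data and the Lie algebra `𝔤` -/

/-- A non-degenerate symmetric bilinear form on `𝔥` together with linearly independent simple roots
`α₁, …, α_R ∈ 𝔥*`. -/
structure CartanData (R : ℕ) (𝔥 : Type*) [AddCommGroup 𝔥] [Module ℂ 𝔥] where
  form : LinearMap.BilinForm ℂ 𝔥
  symm : form.IsSymm
  nondegenerate : form.Nondegenerate
  α : Fin R → Module.Dual ℂ 𝔥
  linearIndependent : LinearIndependent ℂ α

variable {R : ℕ} {𝔥 : Type*} [AddCommGroup 𝔥] [Module ℂ 𝔥] [FiniteDimensional ℂ 𝔥]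

/-- `H_i ∈ 𝔥`, the image of `α_i` under `𝔥* ≃ 𝔥`, so `(H_i, h) = α_i(h)`. -/
def CartanData.coroot (C : CartanData R 𝔥) (i : Fin R) : 𝔥 :=
  (LinearMap.BilinForm.toDual C.form C.nondegenerate).symm (C.α i)

/-- `b_{ij} = (α_i, α_j) = ⟨H_i, α_j⟩`. -/
def CartanData.B (C : CartanData R 𝔥) (i j : Fin R) : ℂ := C.α j (C.coroot i)

/-- Generators of `𝔤`. -/
inductive Gen (R : ℕ) (𝔥 : Type*) where
  | E (i : Fin R)
  | F (i : Fin R)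
  | H (h : 𝔥)

/-- The free Lie algebra on the generators of `𝔤`. -/
abbrev FreeGen (R : ℕ) (𝔥 : Type*) := FreeLieAlgebra ℂ (Gen R 𝔥)

/-- A generator of `𝔤`, in the free Lie algebra. -/
abbrev gen (x : Gen R 𝔥) : FreeGen R 𝔥 := FreeLieAlgebra.of ℂ x

/-- The defining relators of `𝔤`: each element listed is set to zero. The last two make
`h ↦ H h` linear. -/
inductive Relator (C : CartanData R 𝔥) : FreeGen R 𝔥 → Prop
  | EF (i j : Fin R) : Relator C (⁅(gen (.E i) : FreeGen R 𝔥), (gen (.F j) : FreeGen R 𝔥)⁆ -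
      if i = j then gen (.H (C.coroot j)) else 0)
  | HE (h : 𝔥) (i : Fin R) : Relator C
      (⁅(gen (.H h) : FreeGen R 𝔥), (gen (.E i) : FreeGen R 𝔥)⁆ - C.α i h • gen (.E i))
  | HF (h : 𝔥) (i : Fin R) : Relator C
      (⁅(gen (.H h) : FreeGen R 𝔥), (gen (.F i) : FreeGen R 𝔥)⁆ + C.α i h • gen (.F i))
  | HH (h h' : 𝔥) : Relator C ⁅(gen (.H h) : FreeGen R 𝔥), (gen (.H h') : FreeGen R 𝔥)⁆
  | add (h h' : 𝔥) : Relator C (gen (.H (h + h')) - (gen (.H h) + gen (.H h')))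
  | smul (c : ℂ) (h : 𝔥) : Relator C (gen (.H (c • h)) - c • gen (.H h))

/-- The ideal generated by the relators. -/
def relIdeal (C : CartanData R 𝔥) : LieIdeal ℂ (FreeGen R 𝔥) :=
  LieSubmodule.lieSpan ℂ (FreeGen R 𝔥) {x | Relator C x}

/-- The Lie algebra `𝔤`. -/
abbrev LieAlg (C : CartanData R 𝔥) := FreeGen R 𝔥 ⧸ relIdeal C

/-- A generator of `𝔤`. -/
def LieAlg.of (C : CartanData R 𝔥) (x : Gen R 𝔥) : LieAlg C := LieSubmodule.Quotient.mk (gen x)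

lemma relIdeal_le_ker (C : CartanData R 𝔥) {L : Type*} [LieRing L] [LieAlgebra ℂ L]
    (f : FreeGen R 𝔥 →ₗ⁅ℂ⁆ L) (hf : ∀ x, Relator C x → f x = 0) : relIdeal C ≤ f.ker :=
  LieSubmodule.lieSpan_le.mpr fun x hx => (LieHom.mem_ker (f := f) (x := x)).mpr (hf x hx)

/-- The universal property of `𝔤`. -/
def LieAlg.lift (C : CartanData R 𝔥) {L : Type*} [LieRing L] [LieAlgebra ℂ L]
    (f : FreeGen R 𝔥 →ₗ⁅ℂ⁆ L) (hf : ∀ x, Relator C x → f x = 0) : LieAlg C →ₗ⁅ℂ⁆ L :=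
  { Submodule.liftQ (relIdeal C).toSubmodule (f : FreeGen R 𝔥 →ₗ[ℂ] L)
      (fun x hx => (LieHom.mem_ker (f := f) (x := x)).mp (relIdeal_le_ker C f hf hx)) with
    map_lie' := by
      rintro ⟨x⟩ ⟨y⟩
      exact f.map_lie x y }

/-! ### The Cartan anti-involution `φ` -/

/-- Images of the generators under `-φ`. -/
def negPhiGen (C : CartanData R 𝔥) : Gen R 𝔥 → LieAlg C
  | .E i => - LieAlg.of C (.F i)
  | .F i => - LieAlg.of C (.E i)
  | .H h => - LieAlg.of C (.H h)

lemma of_relator (C : CartanData R 𝔥) {x : FreeGen R 𝔥} (hx : Relator C x) :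
    (LieSubmodule.Quotient.mk x : LieAlg C) = 0 :=
  LieSubmodule.Quotient.mk_eq_zero'.mpr (LieSubmodule.subset_lieSpan hx)

lemma lie_E_F (C : CartanData R 𝔥) (i j : Fin R) :
    ⁅LieAlg.of C (.E i), LieAlg.of C (.F j)⁆ =
      if i = j then LieAlg.of C (.H (C.coroot j)) else 0 := by
  have h := of_relator C (Relator.EF i j)
  split_ifs at h ⊢ <;> exact sub_eq_zero.mp h

lemma lie_H_E (C : CartanData R 𝔥) (h : 𝔥) (i : Fin R) :
    ⁅LieAlg.of C (.H h), LieAlg.of C (.E i)⁆ = C.α i h • LieAlg.of C (.E i) :=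
  sub_eq_zero.mp (of_relator C (Relator.HE h i))

lemma lie_H_F (C : CartanData R 𝔥) (h : 𝔥) (i : Fin R) :
    ⁅LieAlg.of C (.H h), LieAlg.of C (.F i)⁆ = -(C.α i h • LieAlg.of C (.F i)) :=
  eq_neg_of_add_eq_zero_left (of_relator C (Relator.HF h i))

lemma lie_H_H (C : CartanData R 𝔥) (h h' : 𝔥) :
    ⁅LieAlg.of C (.H h), LieAlg.of C (.H h')⁆ = 0 := of_relator C (Relator.HH h h')

lemma H_add (C : CartanData R 𝔥) (h h' : 𝔥) :
    LieAlg.of C (.H (h + h')) = LieAlg.of C (.H h) + LieAlg.of C (.H h') :=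
  sub_eq_zero.mp (of_relator C (Relator.add h h'))

lemma H_smul (C : CartanData R 𝔥) (c : ℂ) (h : 𝔥) :
    LieAlg.of C (.H (c • h)) = c • LieAlg.of C (.H h) :=
  sub_eq_zero.mp (of_relator C (Relator.smul c h))

/-- The Lie algebra automorphism `-φ`. -/
def negPhi (C : CartanData R 𝔥) : LieAlg C →ₗ⁅ℂ⁆ LieAlg C :=
  LieAlg.lift C (FreeLieAlgebra.lift ℂ (negPhiGen C)) (by
    intro x hx
    cases hx with
    | EF i j =>
      by_cases hij : i = j
      · subst hij
        simp only [if_true, map_sub, LieHom.map_lie, FreeLieAlgebra.lift_of_apply,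
          negPhiGen, neg_lie, lie_neg, neg_neg]
        rw [← lie_skew, lie_E_F, if_pos rfl]; simp
      · simp only [hij, if_false, map_sub, LieHom.map_lie, FreeLieAlgebra.lift_of_apply,
          negPhiGen, neg_lie, lie_neg, neg_neg, map_zero]
        rw [← lie_skew, lie_E_F, if_neg (Ne.symm hij)]; simp
    | HE h i =>
      simp only [map_sub, LieHom.map_lie, map_smul, FreeLieAlgebra.lift_of_apply,
          negPhiGen, neg_lie, lie_neg, neg_neg, lie_H_F]
      simp
    | HF h i =>
      simp only [map_add, LieHom.map_lie, map_smul, FreeLieAlgebra.lift_of_apply,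
          negPhiGen, neg_lie, lie_neg, neg_neg, lie_H_E]
      simp
    | HH h h' =>
      simp only [LieHom.map_lie, FreeLieAlgebra.lift_of_apply,
          negPhiGen, neg_lie, lie_neg, neg_neg, lie_H_H]
    | add h h' =>
      simp only [map_sub, map_add, FreeLieAlgebra.lift_of_apply,
          negPhiGen, H_add]
      abel
    | smul c h =>
      simp only [map_sub, map_smul, FreeLieAlgebra.lift_of_apply,
          negPhiGen, H_smul]
      simp)

/-- The Cartan anti-involution: the linear map `φ` with `φ(E_i) = F_i`, `φ(F_i) = E_i`,
`φ(h) = h` and `φ([x,y]) = -[φ(x), φ(y)]`. -/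
def phi (C : CartanData R 𝔥) : LieAlg C →ₗ[ℂ] LieAlg C := -(negPhi C : LieAlg C →ₗ[ℂ] LieAlg C)

lemma phi_lie (C : CartanData R 𝔥) (x y : LieAlg C) :
    phi C ⁅x, y⁆ = -⁅phi C x, phi C y⁆ := by
  simp [phi]

lemma phi_E (C : CartanData R 𝔥) (i : Fin R) :
    phi C (LieAlg.of C (.E i)) = LieAlg.of C (.F i) := by
  have : negPhi C (LieAlg.of C (.E i)) = -LieAlg.of C (.F i) :=
    FreeLieAlgebra.lift_of_apply (R := ℂ) (negPhiGen C) (Gen.E i)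
  simp [phi, this]

lemma phi_F (C : CartanData R 𝔥) (i : Fin R) :
    phi C (LieAlg.of C (.F i)) = LieAlg.of C (.E i) := by
  have : negPhi C (LieAlg.of C (.F i)) = -LieAlg.of C (.E i) :=
    FreeLieAlgebra.lift_of_apply (R := ℂ) (negPhiGen C) (Gen.F i)
  simp [phi, this]

lemma phi_H (C : CartanData R 𝔥) (h : 𝔥) :
    phi C (LieAlg.of C (.H h)) = LieAlg.of C (.H h) := by
  have : negPhi C (LieAlg.of C (.H h)) = -LieAlg.of C (.H h) :=
    FreeLieAlgebra.lift_of_apply (R := ℂ) (negPhiGen C) (Gen.H h)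
  simp [phi, this]

/-! ### The forms `K`, `S_𝔤` and the kernel of `S_𝔤` -/

/-- `𝔫`, the subalgebra generated by the `F_i`. -/
def nMinus (C : CartanData R 𝔥) : LieSubalgebra ℂ (LieAlg C) :=
  LieSubalgebra.lieSpan ℂ (LieAlg C) (Set.range fun i => LieAlg.of C (.F i))

/-- `𝔫₊`, the subalgebra generated by the `E_i`. -/
def nPlus (C : CartanData R 𝔥) : LieSubalgebra ℂ (LieAlg C) :=
  LieSubalgebra.lieSpan ℂ (LieAlg C) (Set.range fun i => LieAlg.of C (.E i))

/-- The properties that characterise the standard invariant form `K` on `𝔤` (exactly one form has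
them). -/
structure IsStandardForm (C : CartanData R 𝔥) (K : LinearMap.BilinForm ℂ (LieAlg C)) : Prop where
  H_H : ∀ h h', K (LieAlg.of C (.H h)) (LieAlg.of C (.H h')) = C.form h h'
  n_n : ∀ x ∈ nMinus C, ∀ y ∈ nMinus C, K x y = 0
  np_np : ∀ x ∈ nPlus C, ∀ y ∈ nPlus C, K x y = 0
  H_n : ∀ h, ∀ x ∈ nMinus C, K (LieAlg.of C (.H h)) x = 0 ∧ K x (LieAlg.of C (.H h)) = 0
  H_np : ∀ h, ∀ x ∈ nPlus C, K (LieAlg.of C (.H h)) x = 0 ∧ K x (LieAlg.of C (.H h)) = 0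
  F_E : ∀ i j, K (LieAlg.of C (.F i)) (LieAlg.of C (.E j)) = if i = j then 1 else 0
  E_F : ∀ i j, K (LieAlg.of C (.E i)) (LieAlg.of C (.F j)) = if i = j then 1 else 0
  invariant : ∀ x y z, K ⁅x, y⁆ z = K x ⁅y, z⁆

/-- `S_𝔤(x, y) = -K(φ(x), y)`. -/
def shapovalov (C : CartanData R 𝔥) (K : LinearMap.BilinForm ℂ (LieAlg C)) :
    LinearMap.BilinForm ℂ (LieAlg C) := -(K.comp (phi C) LinearMap.id)

/-- The ideal `ker S_𝔤` of `𝔤`, where `S_𝔤` is built from the unique standard form `K`. -/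
def kerS (C : CartanData R 𝔥) : LieIdeal ℂ (LieAlg C) where
  carrier := {x | ∀ K, IsStandardForm C K → ∀ y, shapovalov C K x y = 0}
  zero_mem' := by intro K _ y; simp
  add_mem' := by intro a b ha hb K hK y; simp [ha K hK y, hb K hK y]
  smul_mem' := by intro c a ha K hK y; simp [ha K hK y]
  lie_mem := by
    intro x m hm K hK y
    have h := hm K hK ⁅phi C x, y⁆
    simp only [shapovalov, LinearMap.neg_apply, LinearMap.BilinForm.comp_apply,
      LinearMap.id_apply, neg_eq_zero] at h ⊢
    rw [phi_lie, lie_skew, hK.invariant]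
    exact h

/-! ### The `𝔫`-component of an element of `𝔤`

`𝔫` is the free Lie algebra on the `F_i`, so that `U(𝔫)` is the free associative algebra on the `F_i`
and has the words in the `F_i` as a basis. The Verma module of highest weight `0` is `U(𝔫)` as an
`𝔫`-module and `𝔥`, `𝔫₊` kill its highest weight vector `1`; so the action of `x ∈ 𝔤` on `1` gives
the component of `x` in `𝔫 ⊆ U(𝔫)` along `𝔤 = 𝔫 ⊕ 𝔥 ⊕ 𝔫₊`. -/

/-- The free associative algebra `U(𝔫)`: the word `[i₁, …, iₙ]` stands for `F_{i₁} ⋯ F_{iₙ}`. -/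
abbrev Words (R : ℕ) := List (Fin R) →₀ ℂ

/-- Left multiplication by `F_i`. -/
def actF (i : Fin R) : Module.End ℂ (Words R) := Finsupp.lmapDomain ℂ ℂ (List.cons i)

/-- The action of `h ∈ 𝔥`: a word has weight minus the sum of the roots of its letters. -/
def actH (C : CartanData R 𝔥) (h : 𝔥) : Module.End ℂ (Words R) :=
  Finsupp.linearCombination ℂ fun w => Finsupp.single w (-(w.map fun j => C.α j h).sum)

/-- `E_i` acting on a word: `E_i F_j w = F_j E_i w + δ_{ij} H_i w` and `E_i 1 = 0`. -/
def wordE (C : CartanData R 𝔥) (i : Fin R) : List (Fin R) → Words R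
  | [] => 0
  | j :: w => actF j (wordE C i w) +
      if i = j then actH C (C.coroot i) (Finsupp.single w 1) else 0

/-- The action of `E_i`. -/
def actE (C : CartanData R 𝔥) (i : Fin R) : Module.End ℂ (Words R) :=
  Finsupp.linearCombination ℂ (wordE C i)

/-- The actions of the generators of `𝔤`. -/
def actGen (C : CartanData R 𝔥) : Gen R 𝔥 → Module.End ℂ (Words R)
  | .E i => actE C i
  | .F i => actF i
  | .H h => actH C h

@[simp] lemma actF_single (i : Fin R) (w : List (Fin R)) (c : ℂ) :
    actF i (Finsupp.single w c) = Finsupp.single (i :: w) c := by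
  simp [actF]

@[simp] lemma actH_single (C : CartanData R 𝔥) (h : 𝔥) (w : List (Fin R)) (c : ℂ) :
    actH C h (Finsupp.single w c) = (-(w.map fun j => C.α j h).sum) • Finsupp.single w c := by
  simp [actH, mul_comm]

@[simp] lemma actE_single (C : CartanData R 𝔥) (i : Fin R) (w : List (Fin R)) :
    actE C i (Finsupp.single w 1) = wordE C i w := by
  simp [actE]

lemma actH_actF (C : CartanData R 𝔥) (h : 𝔥) (i : Fin R) (v : Words R) :
    actH C h (actF i v) = actF i (actH C h v) - C.α i h • actF i v := by
  induction v using Finsupp.induction_linear with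
  | zero => simp
  | add u v hu hv => simp only [map_add, hu, hv, smul_add]; abel
  | single w c => 
    simp only [actF_single, actH_single, List.map_cons, List.sum_cons, map_smul]
    rw [← sub_smul]; congr 1; ring

lemma actH_wordE (C : CartanData R 𝔥) (h : 𝔥) (i : Fin R) (w : List (Fin R)) :
    actH C h (wordE C i w) =
      (C.α i h - (w.map fun j => C.α j h).sum) • wordE C i w := by
  induction w with
  | nil => simp [wordE]
  | cons j w ih =>
    by_cases hij : i = j
    · subst hij
      simp only [wordE, if_true, map_add, actH_actF, ih, map_smul, actH_single, List.map_cons,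
        List.sum_cons]
      module
    · simp only [wordE, hij, if_false, add_zero, actH_actF, ih, map_smul, List.map_cons,
        List.sum_cons]
      module

lemma end_ext {f g : Module.End ℂ (Words R)}
    (h : ∀ w, f (Finsupp.single w 1) = g (Finsupp.single w 1)) : f = g :=
  Finsupp.lhom_ext' fun w => LinearMap.ext_ring (h w)

lemma end_lie (f g : Module.End ℂ (Words R)) (v : Words R) : ⁅f, g⁆ v = f (g v) - g (f v) := rfl

/-- The Verma module of highest weight `0`. -/
def verma (C : CartanData R 𝔥) : LieAlg C →ₗ⁅ℂ⁆ Module.End ℂ (Words R) :=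
  LieAlg.lift C (FreeLieAlgebra.lift ℂ (actGen C)) (by
    intro x hx
    cases hx with
    | EF i j =>
      have key : ⁅actE C i, actF (R := R) j⁆ - (if i = j then actH C (C.coroot j) else 0) = 0 := by
        refine end_ext fun w => ?_
        by_cases hij : i = j
        · subst hij; simp [end_lie, wordE]
        · simp [end_lie, wordE, hij]
      by_cases hij : i = j
      · simpa only [hij, if_true, map_sub, LieHom.map_lie, FreeLieAlgebra.lift_of_apply, actGen]
          using key
      · simpa only [hij, if_false, map_sub, map_zero, LieHom.map_lie, FreeLieAlgebra.lift_of_apply,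
          actGen] using key
    | HE h i =>
      have key : ⁅actH C h, actE C i⁆ - C.α i h • actE C i = 0 := by
        refine end_ext fun w => ?_
        simp only [end_lie, LinearMap.sub_apply,
          actE_single, actH_wordE, actH_single, map_smul, LinearMap.smul_apply,
          LinearMap.zero_apply]
        module
      simpa [actGen] using key
    | HF h i =>
      have key : ⁅actH C h, actF (R := R) i⁆ + C.α i h • actF (R := R) i = 0 := by
        refine LinearMap.ext fun v => ?_
        simp only [end_lie, LinearMap.add_apply, actH_actF, LinearMap.smul_apply, LinearMap.zero_apply]
        module
      simpa [actGen] using key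
    | HH h h' =>
      have key : ⁅actH (R := R) C h, actH C h'⁆ = 0 := by
        refine end_ext fun w => ?_
        simp only [end_lie, LinearMap.sub_apply,
          actH_single, map_smul, LinearMap.zero_apply]
        module
      simpa [actGen] using key
    | add h h' =>
      have key : actH (R := R) C (h + h') - (actH C h + actH C h') = 0 := by
        refine end_ext fun w => ?_
        have hs : (w.map fun j => C.α j h + C.α j h').sum =
            (w.map fun j => C.α j h).sum + (w.map fun j => C.α j h').sum :=
          List.sum_map_add
        simp only [LinearMap.sub_apply, LinearMap.add_apply, actH_single, map_add, hs,
          LinearMap.zero_apply]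
        module
      simpa [actGen] using key
    | smul c h =>
      have key : actH (R := R) C (c • h) - c • actH C h = 0 := by
        refine end_ext fun w => ?_
        have hs : (w.map fun j => c * C.α j h).sum = c * (w.map fun j => C.α j h).sum :=
          List.sum_map_mul_left ..
        simp only [LinearMap.sub_apply, LinearMap.smul_apply, actH_single, map_smul, smul_eq_mul,
          hs, LinearMap.zero_apply]
        module
      simpa [actGen] using key)

/-- The component in `𝔫 ⊆ U(𝔫)` of an element of `𝔤 = 𝔫 ⊕ 𝔥 ⊕ 𝔫₊`. -/
def nComponent (C : CartanData R 𝔥) : LieAlg C →ₗ[ℂ] Words R :=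
  (LinearMap.applyₗ (Finsupp.single [] 1)).comp
    (verma C : LieAlg C →ₗ[ℂ] Module.End ℂ (Words R))

/-! ### Flags of the arrangement `t_p = ω^k t_q` -/

/-- Labels `(p, q, k)`, `p < q`, of the hyperplanes `t_p = ω^k t_q` in `ℂ^m`, `k ∈ ℤ/T`. -/
abbrev Diag (m T : ℕ) := {h : Fin m × Fin m × ZMod T // h.1 < h.2.1}

/-- The hyperplane `t_p = ω^k t_q`. -/
def Diag.hyperplane {m T : ℕ} (ω : ℂ) (h : Diag m T) : Submodule ℂ (Fin m → ℂ) :=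
  LinearMap.ker (LinearMap.proj (R := ℂ) (φ := fun _ : Fin m => ℂ) h.1.1 -
    ω ^ h.1.2.2.val • LinearMap.proj (R := ℂ) (φ := fun _ : Fin m => ℂ) h.1.2.1)

open Classical in
/-- The pairing of a flag `L 0 ⊃ L 1 ⊃ ⋯ ⊃ L k` with `H 1 ∧ ⋯ ∧ H k`: it is the sign of the
permutation `s` such that `L i = H (s 1) ∩ ⋯ ∩ H (s i)` for all `i`, if there is one (it is then
unique), and zero otherwise. -/
def flagPairing {m k : ℕ} (L : ℕ → Submodule ℂ (Fin m → ℂ))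
    (H : Fin k → Submodule ℂ (Fin m → ℂ)) : ℂ :=
  ∑ s : Equiv.Perm (Fin k),
    if ∀ i : Fin k, L (i + 1) = ⨅ l : Fin k, ⨅ _ : l ≤ i, H (s l)
    then ((Equiv.Perm.sign s : ℤ) : ℂ) else 0

/-- The geometric form, for the weighting `a` of the hyperplanes, on full flags in `ℂ^m`: the sum of
`⟨L, H₁ ∧ ⋯ ∧ H_m⟩ ⟨L', H₁ ∧ ⋯ ∧ H_m⟩ a(H₁) ⋯ a(H_m)` over all unordered `m`-tuples of hyperplanes
`t_p = ω^k t_q`. (The summand does not depend on the order and vanishes on tuples with repetitions,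
so this is the sum over the ordered tuples divided by `m!`.) -/
def geometricForm {m T : ℕ} [NeZero T] (ω : ℂ) (a : Diag m T → ℂ)
    (L L' : ℕ → Submodule ℂ (Fin m → ℂ)) : ℂ :=
  (m.factorial : ℂ)⁻¹ * ∑ H : Fin m → Diag m T,
    flagPairing L (fun i => (H i).hyperplane ω) * flagPairing L' (fun i => (H i).hyperplane ω) *
      ∏ i, a (H i)

/-! ### Words in the free Lie algebra `𝔞` and the flags of commutators

`𝔞` is the free Lie algebra on letters `f^k_p`, `k ∈ ℤ/T`, `p ∈ {1, …, m}`, and `U(𝔞)_{[1^m]}` has as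
a basis the words in which every index `p` occurs exactly once. -/

/-- The word `f^{κ(1)}_{e(1)} ⋯ f^{κ(m)}_{e(m)}` is given by `(e, κ)`. -/
abbrev MWord (m T : ℕ) := Equiv.Perm (Fin m) × (Fin m → ZMod T)

/-- For a word `x₁ ⋯ x_m` with `x_a = f^{κ(a)}_{e(a)}`, the flag of the iterated commutator
`[⋯[[x₁, x₂], x₃], ⋯, x_m]`, completed by its last edge `{0}`: for `j < m` the edge `L j` is
`ω^{κ(1)} t_{e(1)} = ⋯ = ω^{κ(j+1)} t_{e(j+1)}`, and `L m = {0}`. -/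
def MWord.flag {m T : ℕ} (ω : ℂ) (u : MWord m T) (j : ℕ) : Submodule ℂ (Fin m → ℂ) :=
  if j < m then
    ⨅ a : Fin m, ⨅ b : Fin m, ⨅ _ : (a : ℕ) ≤ j, ⨅ _ : (b : ℕ) ≤ j,
      LinearMap.ker
        (ω ^ (u.2 a).val • LinearMap.proj (R := ℂ) (φ := fun _ : Fin m => ℂ) (u.1 a) -
          ω ^ (u.2 b).val • LinearMap.proj (R := ℂ) (φ := fun _ : Fin m => ℂ) (u.1 b))
  else ⊥

/-- The sign with which that flag is `ψ` of the commutator: `f̄_1 ∧ ⋯ ∧ f̄_m` corresponds to the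
trivial flag `ℂ^m`, and replacing `ḡ₂ ∧ ḡ₁` at the end of a wedge product by the projection of
`[g₁, g₂]` adds a step to the flag; so the commutator arises from `x̄_m ∧ ⋯ ∧ x̄_1`. -/
def MWord.sign {m T : ℕ} (u : MWord m T) : ℂ :=
  ((Equiv.Perm.sign (Fin.revPerm.trans u.1) : ℤ) : ℂ)

/-- The form `Geom₀`, for Lie elements of `U(𝔞)_{[1^m]}` fixed by `τ : f^k_p ↦ f^{k+1}_p`. Such an
element `x = ∑ c_u u` is `(1/m) ∑ c_u ℓ(u)`, where `ℓ(u)` is the iterated commutator of the letters of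
`u` (Dynkin–Specht–Wever), and it is `1/T` times its own projection `x̄ = ∑_k τ^k x`; so
`ψ(x v₀) = (1/(mT)) ∑ c_u ψ(ℓ(u)‾ v₀)`, and `ψ(ℓ(u)‾ v₀)` is the flag of `u` with its sign. -/
def geom0 {m T : ℕ} [NeZero T] (ω : ℂ) (a : Diag m T → ℂ) :
    LinearMap.BilinForm ℂ (MWord m T → ℂ) :=
  Matrix.toBilin' (Matrix.of fun u u' : MWord m T =>
    ((m : ℂ) * T)⁻¹ * ((m : ℂ) * T)⁻¹ * u.sign * u'.sign *
      geometricForm ω a (u.flag ω) (u'.flag ω))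

/-! ### Symmetrization -/

variable {r : ℕ}

/-- The index `i` of the block of `λ_i` consecutive elements of `{1, …, m}`, `m = λ_1 + ⋯ + λ_r`,
that contains `p`. -/
def block (lam : Fin r → ℕ) (p : Fin (∑ i, lam i)) : Fin r := (finSigmaFinEquiv.symm p).1

open Classical in
/-- The symmetrization map `𝗌 : U(𝔫) → U(𝔞)_{[1^m]}` for the weight `λ`, `m = λ_1 + ⋯ + λ_r`: the
algebra homomorphism that sends `F_j` to the sum of all the letters `f^k_p` with
`σ^k(ι(block of p)) = j`, followed by the projection onto the words in which every index occurs
exactly once. -/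
def symmetrize (T : ℕ) (σ : Equiv.Perm (Fin R)) (ι : Fin r → Fin R) (lam : Fin r → ℕ) :
    Words R →ₗ[ℂ] (MWord (∑ i, lam i) T → ℂ) :=
  Finsupp.linearCombination ℂ fun w u =>
    if w = List.ofFn (fun a => (σ ^ (u.2 a).val) (ι (block lam (u.1 a)))) then 1 else 0

/-- The weighting `a(t_p = ω^k t_q) = (α_{ι(i)}, σ^k α_{ι(j)})`, for `p` in block `i` and `q` in
block `j`. -/
def CartanData.weighting (C : CartanData R 𝔥) {T : ℕ} (σ : Equiv.Perm (Fin R)) (ι : Fin r → Fin R)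
    (lam : Fin r → ℕ) (h : Diag (∑ i, lam i) T) : ℂ :=
  C.B (ι (block lam h.1.1)) ((σ ^ h.1.2.2.val) (ι (block lam h.1.2.1)))

/-- `∏_i (T/T_i)^{λ_i} λ_i!`, the order of the symmetrization group, `T_i` being the length of the
cycle of `ι(i)`. -/
def symOrder (T : ℕ) (σ : Equiv.Perm (Fin R)) (ι : Fin r → Fin R) (lam : Fin r → ℕ) : ℕ :=
  ∏ i, (T / Function.minimalPeriod σ (ι i)) ^ lam i * (lam i).factorial

open Classical in
/-- The weight of a word: `λ_i` is the number of its letters in the cycle of `ι(i)`. -/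
def wordWeight (σ : Equiv.Perm (Fin R)) (ι : Fin r → Fin R) (w : List (Fin R)) (i : Fin r) : ℕ :=
  w.countP fun j => decide (σ.SameCycle (ι i) j)

/-- The bilinear form that is `(x, y) ↦ (1/|ΣZ_λ|) Geom₀(𝗌(x), 𝗌(y))` for `x`, `y` both of the
nonzero weight `λ`, and that is zero on all other pairs of weight components. (For `x` of weight `λ`
and `y` of weight `μ ≠ λ`, the symmetrization of `y` with respect to `λ` is zero.) -/
def symGeom (C : CartanData R 𝔥) (T : ℕ) [NeZero T] (ω : ℂ) (σ : Equiv.Perm (Fin R))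
    (ι : Fin r → Fin R) : Words R →ₗ[ℂ] Words R →ₗ[ℂ] ℂ :=
  Finsupp.linearCombination ℂ fun w =>
    if wordWeight σ ι w = 0 then 0
    else (symOrder T σ ι (wordWeight σ ι w) : ℂ)⁻¹ •
      (geom0 ω (C.weighting (T := T) σ ι (wordWeight σ ι w))
        (symmetrize T σ ι (wordWeight σ ι w) (Finsupp.single w 1))).comp
      (symmetrize T σ ι (wordWeight σ ι w))

/-! ### Diagram automorphisms, the fixed-point algebras and the cocycle `Ω` -/

/-- A diagram automorphism of `𝔤`. -/
structure DiagramAut (C : CartanData R 𝔥) where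
  perm : Equiv.Perm (Fin R)
  aut : LieAlg C ≃ₗ⁅ℂ⁆ LieAlg C
  map_F : ∀ i, aut (LieAlg.of C (.F i)) = LieAlg.of C (.F (perm i))
  map_E : ∀ i, aut (LieAlg.of C (.E i)) = LieAlg.of C (.E (perm i))
  map_H : ∀ i, aut (LieAlg.of C (.H (C.coroot i))) = LieAlg.of C (.H (C.coroot (perm i)))

variable {C : CartanData R 𝔥}

/-- The subalgebra `𝔤^σ` of fixed points. -/
def DiagramAut.fixed (σ : DiagramAut C) : LieSubalgebra ℂ (LieAlg C) where
  carrier := {x | σ.aut x = x}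
  zero_mem' := by simp
  add_mem' := by intro a b ha hb; simp_all
  smul_mem' := by intro c a ha; simp_all
  lie_mem' := by
    intro a b ha hb
    change σ.aut ⁅a, b⁆ = ⁅a, b⁆
    rw [LieEquiv.map_lie, show σ.aut a = a from ha, show σ.aut b = b from hb]

/-- The ideal `ker S_𝔤 ∩ 𝔤^σ` of `𝔤^σ`. -/
def DiagramAut.fixedKer (σ : DiagramAut C) : LieIdeal ℂ σ.fixed :=
  LieIdeal.comap σ.fixed.incl (kerS C)

/-- The Lie algebra `(𝔤 / ker S_𝔤)^σ = 𝔤^σ / (ker S_𝔤 ∩ 𝔤^σ)`. -/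
abbrev DiagramAut.fixedQuot (σ : DiagramAut C) := σ.fixed ⧸ σ.fixedKer

/-- The skew-symmetric form `Ω` on `𝔤^σ`: for a nonzero weight `λ`, `x ∈ 𝔫₊^σ` and `y ∈ 𝔫^σ` of
weight `λ`, `Ω(x, y) = -Ω(y, x) = (1/|ΣZ_λ|) Geom₀(φ(𝗌(x)), 𝗌(y))`, where `φ(𝗌(x)) = 𝗌(φ(x))`; on
all other components of the weight decomposition it is zero. (The `𝔫`-component of `φ(x)` is `φ` of
the `𝔫₊`-component of `x`.) -/
def DiagramAut.Omega (σ : DiagramAut C) (T : ℕ) [NeZero T] (ω : ℂ) (ι : Fin r → Fin R) :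
    σ.fixed →ₗ[ℂ] σ.fixed →ₗ[ℂ] ℂ :=
  let N : LieAlg C →ₗ[ℂ] LieAlg C →ₗ[ℂ] ℂ :=
    (symGeom C T ω σ.perm ι).compl₁₂ (nComponent C ∘ₗ phi C) (nComponent C)
  (N - N.flip).compl₁₂ (σ.fixed.incl : σ.fixed →ₗ[ℂ] LieAlg C)
    (σ.fixed.incl : σ.fixed →ₗ[ℂ] LieAlg C)

end CyclotomicOmega

end

noncomputable section
attribute [local instance 100] LieRing.ofAssociativeRing
namespace CyclotomicOmega
variable {R : ℕ} {𝔥 : Type*} [AddCommGroup 𝔥] [Module ℂ 𝔥] [FiniteDimensional ℂ 𝔥]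
variable {r : ℕ}

/-! ### Vanishing of `symGeom` -/

/-! The mechanism is a degree count. `Ω` pairs a degree `m` part of `𝔫₊^σ` with the degree `m` part
of `𝔫^σ`, and a bracket of two such parts lands in the span of the coroots. Averaged over `σ`, that
span is already spanned by the brackets `[∑_k σ^k E_j, ∑_k σ^k F_j]`. On these, a functional `α`
with `Ω = α([·,·])` takes the values of `Ω` in degree one, where `Ω` is zero: an arrangement in
`ℂ^1` has no hyperplanes `t_p = ω^k t_q` with `p < q`. Hence `α` vanishes wherever it could
contribute, and `Ω = 0`.

Since `T x = ∑_{k<T} σ^k x` for fixed `x`, it suffices to evaluate the half form `halfOmega` on such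
sums, with `x` and `y` split along the triangular decomposition (`exists_triangular`). The `𝔥` parts
contribute only degree at most one (`nComponent_mem_of_lie_F`), and `symGeom_eq_zero_of_forall_ne`
kills these together with all pairs of different degrees. What remains are iterated brackets of `E`s
against equally long brackets of `F`s; there `lie_monE_mem_lowerPart` puts the bracket in the span
of the coroots and `apply_trace_eq_zero` concludes. The case of the quotient by `ker S_𝔤` follows by
pulling the functional back. -/

lemma geom0_eq_zero {m T : ℕ} [NeZero T] (hm : m = 1) (ω : ℂ) (a : Diag m T → ℂ) :
    geom0 ω a = 0 := by
  subst hm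
  -- With one coordinate there is no pair `p < q`, so the sum defining the geometric form is empty.
  have : IsEmpty (Diag 1 T) := ⟨fun h => by
    have h1 := h.2
    rw [Subsingleton.elim h.1.1 h.1.2.1] at h1
    exact lt_irrefl _ h1⟩
  have h0 : ∀ L L', geometricForm ω a L L' = 0 := by
    intro L L'
    simp [geometricForm]
  unfold geom0
  simp only [h0, mul_zero]
  exact map_zero Matrix.toBilin'

/-- The cycles of the `ι(i)` partition the alphabet, so each letter is counted exactly once. -/
lemma sum_wordWeight (σ : Equiv.Perm (Fin R)) (ι : Fin r → Fin R)
    (hι : ∀ j, ∃! i, σ.SameCycle (ι i) j) (w : List (Fin R)) :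
    ∑ i, wordWeight σ ι w i = w.length := by
  classical
  induction w with
  | nil => simp [wordWeight]
  | cons j w ih =>
    obtain ⟨i, hi, hu⟩ := hι j
    have : ∀ k, wordWeight σ ι (j :: w) k = wordWeight σ ι w k + if k = i then 1 else 0 := by
      intro k
      simp only [wordWeight, List.countP_cons, decide_eq_true_eq]
      congr 1
      by_cases hk : k = i
      · subst hk; simp [hi]
      · have : ¬ σ.SameCycle (ι k) j := fun h => hk (hu k h)
        simp [hk, this]
    simp [this, Finset.sum_add_distrib, ih]

/-- Every word that uses each of the `m` indices once has length `m`, and symmetrization preserves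
length. -/
lemma symmetrize_single_eq_zero (T : ℕ) (σ : Equiv.Perm (Fin R)) (ι : Fin r → Fin R)
    (lam : Fin r → ℕ) {w : List (Fin R)} (hw : w.length ≠ ∑ i, lam i) (c : ℂ) :
    symmetrize T σ ι lam (Finsupp.single w c) = 0 := by
  funext u
  have : w ≠ List.ofFn (fun a => (σ ^ (u.2 a).val) (ι (block lam (u.1 a)))) := by
    intro h
    apply hw
    rw [h, List.length_ofFn]
  simp [symmetrize, this]

lemma symGeom_single_single_of_length_ne (C : CartanData R 𝔥) (T : ℕ) [NeZero T] (ω : ℂ)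
    (σ : Equiv.Perm (Fin R)) (ι : Fin r → Fin R) (hι : ∀ j, ∃! i, σ.SameCycle (ι i) j)
    {w w' : List (Fin R)} (h : w.length ≠ w'.length) (c c' : ℂ) :
    symGeom C T ω σ ι (Finsupp.single w c) (Finsupp.single w' c') = 0 := by
  classical
  have h0 := symmetrize_single_eq_zero T σ ι (wordWeight σ ι w) (w := w')
    (by rw [sum_wordWeight σ ι hι]; exact h.symm) c'
  simp only [symGeom, Finsupp.linearCombination_single, LinearMap.smul_apply]
  split_ifs
  · simp
  · simp [h0]

lemma symGeom_single_of_length_le_one (C : CartanData R 𝔥) (T : ℕ) [NeZero T] (ω : ℂ)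
    (σ : Equiv.Perm (Fin R)) (ι : Fin r → Fin R) (hι : ∀ j, ∃! i, σ.SameCycle (ι i) j)
    {w : List (Fin R)} (h : w.length ≤ 1) (c : ℂ) :
    symGeom C T ω σ ι (Finsupp.single w c) = 0 := by
  classical
  simp only [symGeom, Finsupp.linearCombination_single]
  split_ifs with hw
  · simp
  -- A word of nonzero weight is nonempty, so its length is exactly one and the arrangement is that
  -- of `ℂ^1`.
  · have h1 : ∑ i, wordWeight σ ι w i = 1 := by
      rw [sum_wordWeight σ ι hι]
      refine le_antisymm h (Nat.one_le_iff_ne_zero.mpr fun h0 => hw ?_)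
      rw [List.length_eq_zero_iff.mp h0]
      funext i
      simp [wordWeight]
    rw [geom0_eq_zero h1]
    simp

/-- The span of the words whose length satisfies `p`. -/
def ofLength (R : ℕ) (p : ℕ → Prop) : Submodule ℂ (Words R) :=
  Finsupp.supported ℂ ℂ {w : List (Fin R) | p w.length}

lemma ofLength_eq_span (p : ℕ → Prop) : ofLength R p =
    Submodule.span ℂ ((fun w => Finsupp.single w 1) '' {w : List (Fin R) | p w.length}) :=
  Finsupp.supported_eq_span_single ℂ _

lemma single_mem_ofLength {p : ℕ → Prop} {w : List (Fin R)} (h : p w.length) (c : ℂ) :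
    Finsupp.single w c ∈ ofLength R p :=
  Finsupp.single_mem_supported ℂ c h

lemma ofLength_mono {p q : ℕ → Prop} (h : ∀ n, p n → q n) : ofLength R p ≤ ofLength R q :=
  Finsupp.supported_mono (Set.ofPred_subset_ofPred.mpr fun w hw => h w.length hw)

/-- Words of different lengths are orthogonal and words of length at most one lie in the kernel.
Length predicates allow both facts to be applied at once to homogeneous elements and to elements of
bounded or arbitrary degree. -/
lemma symGeom_eq_zero_of_forall_ne (C : CartanData R 𝔥) (T : ℕ) [NeZero T] (ω : ℂ)
    (σ : Equiv.Perm (Fin R)) (ι : Fin r → Fin R) (hι : ∀ j, ∃! i, σ.SameCycle (ι i) j)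
    {p q : ℕ → Prop} (hpq : ∀ n, p n → q n → n ≤ 1) {u v : Words R}
    (hu : u ∈ ofLength R p) (hv : v ∈ ofLength R q) : symGeom C T ω σ ι u v = 0 := by
  rw [ofLength_eq_span] at hu hv
  induction hu, hv using Submodule.span_induction₂ with
  | mem_mem x y hx hy =>
    obtain ⟨w, hw, rfl⟩ := hx
    obtain ⟨w', hw', rfl⟩ := hy
    by_cases h : w.length = w'.length
    · rw [symGeom_single_of_length_le_one C T ω σ ι hι
        (hpq _ hw (by simpa only [Set.mem_ofPred_eq, h] using hw'))]
      rfl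
    · exact symGeom_single_single_of_length_ne C T ω σ ι hι h 1 1
  | zero_left => simp
  | zero_right => simp
  | add_left x y z _ _ _ h1 h2 => simp [h1, h2]
  | add_right x y z _ _ _ h1 h2 => simp [h1, h2]
  | smul_left c x y _ _ h => simp [h]
  | smul_right c x y _ _ h => simp [h]

/-! ### Iterated brackets -/

/-- The iterated bracket `[g_{j₁}, [g_{j₂}, ⋯ g_{j_n}]]`; it is zero for the empty word. -/
def mon {L : Type*} [LieRing L] (g : Fin R → L) : List (Fin R) → L
  | [] => 0
  | [j] => g j
  | j :: k :: w => ⁅g j, mon g (k :: w)⁆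

section mon
variable {L L' : Type*} [LieRing L] [LieRing L']

lemma mon_cons (g : Fin R → L) (j : Fin R) {w : List (Fin R)} (hw : w ≠ []) :
    mon g (j :: w) = ⁅g j, mon g w⁆ := by
  cases w with
  | nil => exact absurd rfl hw
  | cons k w => rfl

/-- Induction on nonempty words, for iterated brackets. -/
lemma mon_induction (g : Fin R → L) {P : List (Fin R) → L → Prop} (nil : P [] 0)
    (single : ∀ j, P [j] (g j))
    (cons : ∀ j w, w ≠ [] → P w (mon g w) → P (j :: w) ⁅g j, mon g w⁆) (w : List (Fin R)) :
    P w (mon g w) := by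
  induction w with
  | nil => exact nil
  | cons j w ih =>
    by_cases hw : w = []
    · subst hw; exact single j
    · rw [mon_cons g j hw]; exact cons j w hw ih

lemma mon_comp (g : Fin R → L) (s : Fin R → Fin R) (w : List (Fin R)) :
    mon (fun j => g (s j)) w = mon g (w.map s) := by
  induction w with
  | nil => rfl
  | cons j w ih =>
    by_cases hw : w = []
    · subst hw; rfl
    · rw [mon_cons _ j hw, List.map_cons, mon_cons _ _ (by simpa using hw), ih]

/-- With a single letter the innermost bracket is `[g, g]`. -/
lemma mon_eq_zero_of_subsingleton [Subsingleton (Fin R)] (g : Fin R → L) (w : List (Fin R))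
    (hw : 2 ≤ w.length) : mon g w = 0 := by
  induction w with
  | nil => simp at hw
  | cons j w ih =>
    cases w with
    | nil => simp at hw
    | cons k w =>
      rw [mon_cons g j (by simp)]
      cases w with
      | nil => rw [Subsingleton.elim j k]; exact lie_self _
      | cons l w => rw [ih (by simp), lie_zero]

variable [LieAlgebra ℂ L] [LieAlgebra ℂ L']

lemma map_mon (f : L →ₗ⁅ℂ⁆ L') (g : Fin R → L) (w : List (Fin R)) :
    f (mon g w) = mon (fun j => f (g j)) w := by
  refine mon_induction g (P := fun w x => f x = mon (fun j => f (g j)) w) ?_ ?_ ?_ w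
  · simp [mon]
  · intro j; rfl
  · intro j w hw h
    rw [mon_cons _ j hw, LieHom.map_lie, h]

lemma lie_mon_of_eigen (g : Fin R → L) (h : L) (c : Fin R → ℂ) (hc : ∀ j, ⁅h, g j⁆ = c j • g j)
    (w : List (Fin R)) : ⁅h, mon g w⁆ = (w.map c).sum • mon g w := by
  refine mon_induction g (P := fun w x => ⁅h, x⁆ = (w.map c).sum • x) ?_ ?_ ?_ w
  · simp
  · intro j; simpa using hc j
  · intro j w hw ih
    rw [leibniz_lie, hc, ih, List.map_cons, List.sum_cons, smul_lie, lie_smul, add_smul]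

lemma mon_neg (g : Fin R → L) (w : List (Fin R)) :
    mon (fun j => -g j) w = (-1 : ℂ) ^ w.length • mon g w := by
  refine mon_induction g
    (P := fun w x => mon (fun j => -g j) w = (-1 : ℂ) ^ w.length • x) ?_ ?_ ?_ w
  · simp [mon]
  · intro j; simp [mon]
  · intro j w hw ih
    rw [mon_cons _ j hw, ih, List.length_cons, pow_succ, neg_lie, lie_smul, mul_neg_one, neg_smul]

end mon
-- Brackets of simple root vectors and their degrees
/-- The iterated brackets of the `F_j`. -/
abbrev monF (C : CartanData R 𝔥) (w : List (Fin R)) : LieAlg C := mon (fun j => LieAlg.of C (.F j)) w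

/-- The iterated brackets of the `E_j`. -/
abbrev monE (C : CartanData R 𝔥) (w : List (Fin R)) : LieAlg C := mon (fun j => LieAlg.of C (.E j)) w

lemma phi_monE (C : CartanData R 𝔥) (w : List (Fin R)) :
    phi C (monE C w) = -((-1 : ℂ) ^ w.length • monF C w) := by
  have h : ∀ j, negPhi C (LieAlg.of C (.E j)) = -LieAlg.of C (.F j) := fun j => by
    rw [← phi_E]; simp [phi]
  change -(negPhi C (monE C w)) = _
  rw [map_mon]
  simp only [h, mon_neg]

lemma phi_monF (C : CartanData R 𝔥) (w : List (Fin R)) :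
    phi C (monF C w) = -((-1 : ℂ) ^ w.length • monE C w) := by
  have h : ∀ j, negPhi C (LieAlg.of C (.F j)) = -LieAlg.of C (.E j) := fun j => by
    rw [← phi_F]; simp [phi]
  change -(negPhi C (monF C w)) = _
  rw [map_mon]
  simp only [h, mon_neg]

/-- The iterated brackets of `n` of the `F_j`, for `n > 0`, and the coroots, for `n = 0`. -/
def lowerPart (C : CartanData R 𝔥) : ℕ → Submodule ℂ (LieAlg C)
  | 0 => Submodule.span ℂ (Set.range fun j => LieAlg.of C (.H (C.coroot j)))
  | n + 1 => Submodule.span ℂ (monF C '' {w | w.length = n + 1})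

lemma monF_mem_lowerPart (C : CartanData R 𝔥) {w : List (Fin R)} (hw : w ≠ []) :
    monF C w ∈ lowerPart C w.length := by
  cases w with
  | nil => exact absurd rfl hw
  | cons j w => exact Submodule.subset_span ⟨j :: w, rfl, rfl⟩

lemma lie_F_mem_lowerPart (C : CartanData R 𝔥) (i : Fin R) (n : ℕ) {v : LieAlg C}
    (hv : v ∈ lowerPart C n) : ⁅LieAlg.of C (.F i), v⁆ ∈ lowerPart C (n + 1) := by
  cases n with
  | zero =>
    induction hv using Submodule.span_induction with
    | mem x hx =>
      obtain ⟨j, rfl⟩ := hx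
      simp only
      rw [← lie_skew, lie_H_F, neg_neg]
      exact Submodule.smul_mem _ _ (monF_mem_lowerPart C (w := [i]) (by simp))
    | zero => simp
    | add x y _ _ hx hy => rw [lie_add]; exact add_mem hx hy
    | smul c x _ hx => rw [lie_smul]; exact Submodule.smul_mem _ _ hx
  | succ n =>
    induction hv using Submodule.span_induction with
    | mem x hx =>
      obtain ⟨w, hw, rfl⟩ := hx
      have hw : w.length = n + 1 := hw
      have h0 : w ≠ [] := by rintro rfl; simp at hw
      have h := monF_mem_lowerPart C (w := i :: w) (by simp)
      rwa [monF, mon_cons _ _ h0, List.length_cons, hw] at h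
    | zero => simp
    | add x y _ _ hx hy => rw [lie_add]; exact add_mem hx hy
    | smul c x _ hx => rw [lie_smul]; exact Submodule.smul_mem _ _ hx

lemma lie_H_monF (C : CartanData R 𝔥) (h : 𝔥) (w : List (Fin R)) :
    ⁅LieAlg.of C (.H h), monF C w⁆ = (w.map fun j => -C.α j h).sum • monF C w :=
  lie_mon_of_eigen _ _ _ (fun j => by rw [lie_H_F, neg_smul]) w

/-- `ad E_i` is a derivation that replaces a letter `F_j` by `δ_{ij} H_j`. In a longer bracket this
coroot acts on the remaining bracket by a scalar, so coroots themselves survive only in degree zero.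
-/
lemma lie_E_monF_mem (C : CartanData R 𝔥) (i : Fin R) (w : List (Fin R)) (hw : w ≠ []) :
    ⁅LieAlg.of C (.E i), monF C w⁆ ∈ lowerPart C (w.length - 1) := by
  induction w with
  | nil => exact absurd rfl hw
  | cons j w ih =>
    by_cases h0 : w = []
    · subst h0
      change ⁅LieAlg.of C (.E i), LieAlg.of C (.F j)⁆ ∈ lowerPart C 0
      rw [lie_E_F]
      split_ifs
      · exact Submodule.subset_span ⟨j, rfl⟩
      · exact zero_mem _
    · rw [monF, mon_cons _ _ h0, leibniz_lie, lie_E_F, List.length_cons, Nat.add_sub_cancel]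
      refine add_mem ?_ ?_
      · split_ifs
        · rw [lie_H_monF]
          exact Submodule.smul_mem _ _ (monF_mem_lowerPart C h0)
        · simp
      · have h := lie_F_mem_lowerPart C j _ (ih h0)
        rwa [Nat.sub_add_cancel (List.length_pos_iff.mpr h0)] at h

lemma lie_E_mem_lowerPart (C : CartanData R 𝔥) (i : Fin R) (n : ℕ) {v : LieAlg C}
    (hv : v ∈ lowerPart C (n + 1)) : ⁅LieAlg.of C (.E i), v⁆ ∈ lowerPart C n := by
  induction hv using Submodule.span_induction with
  | mem x hx =>
    obtain ⟨w, hw, rfl⟩ := hx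
    have hw : w.length = n + 1 := hw
    have h := lie_E_monF_mem C i w (by rintro rfl; simp at hw)
    rwa [hw] at h
  | zero => simp
  | add x y _ _ hx hy => rw [lie_add]; exact add_mem hx hy
  | smul c x _ hx => rw [lie_smul]; exact Submodule.smul_mem _ _ hx

/-- Each `E` lowers the degree by one, and `ad` of a bracket is a commutator of such lowering
operators. The case `n = 0` sends brackets of equal length into the span of the coroots, not merely
into `𝔥`. -/
lemma lie_monE_mem_lowerPart (C : CartanData R 𝔥) (w : List (Fin R)) :
    ∀ (n : ℕ) (v : LieAlg C), v ∈ lowerPart C (n + w.length) →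
      ⁅monE C w, v⁆ ∈ lowerPart C n := by
  induction w with
  | nil => intro n v _; simp [mon]
  | cons j w ih =>
    intro n v hv
    rw [List.length_cons, ← add_assoc] at hv
    by_cases h0 : w = []
    · subst h0
      exact lie_E_mem_lowerPart C j n hv
    · rw [monE, mon_cons _ _ h0, lie_lie]
      refine sub_mem (lie_E_mem_lowerPart C j n (ih _ _ ?_)) (ih _ _ (lie_E_mem_lowerPart C j _ hv))
      rwa [add_right_comm]

/-! ### The triangular decomposition -/

/-- The span of the iterated brackets of the `F_j`, of `𝔥`, and of the iterated brackets of the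
`E_j`. -/
def triangular (C : CartanData R 𝔥) : Submodule ℂ (LieAlg C) :=
  Submodule.span ℂ (Set.range (monF C) ∪ (Set.range fun h => LieAlg.of C (.H h)) ∪
    Set.range (monE C))

lemma monF_mem_triangular (C : CartanData R 𝔥) (w : List (Fin R)) : monF C w ∈ triangular C :=
  Submodule.subset_span (Or.inl (Or.inl ⟨w, rfl⟩))

lemma H_mem_triangular (C : CartanData R 𝔥) (h : 𝔥) : LieAlg.of C (.H h) ∈ triangular C :=
  Submodule.subset_span (Or.inl (Or.inr ⟨h, rfl⟩))

lemma monE_mem_triangular (C : CartanData R 𝔥) (w : List (Fin R)) : monE C w ∈ triangular C :=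
  Submodule.subset_span (Or.inr ⟨w, rfl⟩)

lemma triangular_induction (C : CartanData R 𝔥) (S : Submodule ℂ (LieAlg C))
    (hF : ∀ w, monF C w ∈ S) (hH : ∀ h, LieAlg.of C (.H h) ∈ S) (hE : ∀ w, monE C w ∈ S) :
    triangular C ≤ S := by
  refine Submodule.span_le.mpr ?_
  rintro x ((⟨w, rfl⟩ | ⟨h, rfl⟩) | ⟨w, rfl⟩)
  exacts [hF w, hH h, hE w]

lemma lowerPart_le_triangular (C : CartanData R 𝔥) (n : ℕ) : lowerPart C n ≤ triangular C := by
  cases n with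
  | zero =>
    refine Submodule.span_le.mpr ?_
    rintro x ⟨j, rfl⟩
    exact H_mem_triangular C _
  | succ n =>
    refine Submodule.span_le.mpr ?_
    rintro x ⟨w, _, rfl⟩
    exact monF_mem_triangular C _

lemma phi_mem_triangular (C : CartanData R 𝔥) {x : LieAlg C} (hx : x ∈ triangular C) :
    phi C x ∈ triangular C := by
  refine triangular_induction C ((triangular C).comap (phi C)) (fun w => ?_) (fun h => ?_)
    (fun w => ?_) hx
  · rw [Submodule.mem_comap, phi_monF]
    exact neg_mem (Submodule.smul_mem _ _ (monE_mem_triangular C w))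
  · rw [Submodule.mem_comap, phi_H]
    exact H_mem_triangular C h
  · rw [Submodule.mem_comap, phi_monE]
    exact neg_mem (Submodule.smul_mem _ _ (monF_mem_triangular C w))

lemma phi_phi_of_mem (C : CartanData R 𝔥) {x : LieAlg C} (hx : x ∈ triangular C) :
    phi C (phi C x) = x := by
  have hs : ∀ n : ℕ, (-1 : ℂ) ^ n * (-1) ^ n = 1 := fun n => by rw [← mul_pow]; simp
  refine triangular_induction C (LinearMap.eqLocus (phi C ∘ₗ phi C) LinearMap.id) (fun w => ?_)
    (fun h => ?_) (fun w => ?_) hx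
  · simp [LinearMap.mem_eqLocus, phi_monF, phi_monE, smul_smul, hs]
  · simp [LinearMap.mem_eqLocus, phi_H]
  · simp [LinearMap.mem_eqLocus, phi_monF, phi_monE, smul_smul, hs]

lemma lie_E_mem_triangular (C : CartanData R 𝔥) (i : Fin R) {x : LieAlg C}
    (hx : x ∈ triangular C) : ⁅LieAlg.of C (.E i), x⁆ ∈ triangular C := by
  refine triangular_induction C
    ((triangular C).comap (LieAlgebra.ad ℂ (LieAlg C) (LieAlg.of C (.E i)) :
      LieAlg C →ₗ[ℂ] LieAlg C)) (fun w => ?_) (fun h => ?_) (fun w => ?_) hx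
  · rw [Submodule.mem_comap, LieAlgebra.ad_apply]
    by_cases hw : w = []
    · subst hw; simp [mon]
    · exact lowerPart_le_triangular C _ (lie_E_monF_mem C i w hw)
  · rw [Submodule.mem_comap, LieAlgebra.ad_apply, ← lie_skew, lie_H_E]
    exact neg_mem (Submodule.smul_mem _ _ (monE_mem_triangular C [i]))
  · rw [Submodule.mem_comap, LieAlgebra.ad_apply]
    by_cases hw : w = []
    · subst hw; simp [mon]
    · have h := monE_mem_triangular C (i :: w)
      rwa [monE, mon_cons _ _ hw] at h

/-- Conjugating by `φ`, which is an involution on this span, turns `ad F_i` into `-ad E_i`. -/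
lemma lie_F_mem_triangular (C : CartanData R 𝔥) (i : Fin R) {x : LieAlg C}
    (hx : x ∈ triangular C) : ⁅LieAlg.of C (.F i), x⁆ ∈ triangular C := by
  have h := phi_mem_triangular C (lie_E_mem_triangular C i (phi_mem_triangular C hx))
  rw [phi_lie, phi_E, phi_phi_of_mem C hx] at h
  simpa using neg_mem h

lemma lie_H_mem_triangular (C : CartanData R 𝔥) (h : 𝔥) {x : LieAlg C}
    (hx : x ∈ triangular C) : ⁅LieAlg.of C (.H h), x⁆ ∈ triangular C := by
  refine triangular_induction C
    ((triangular C).comap (LieAlgebra.ad ℂ (LieAlg C) (LieAlg.of C (.H h)) :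
      LieAlg C →ₗ[ℂ] LieAlg C)) (fun w => ?_) (fun h' => ?_) (fun w => ?_) hx
  · rw [Submodule.mem_comap, LieAlgebra.ad_apply, lie_H_monF]
    exact Submodule.smul_mem _ _ (monF_mem_triangular C w)
  · rw [Submodule.mem_comap, LieAlgebra.ad_apply, lie_H_H]
    exact zero_mem _
  · rw [Submodule.mem_comap, LieAlgebra.ad_apply, lie_mon_of_eigen _ _ _ (lie_H_E C h)]
    exact Submodule.smul_mem _ _ (monE_mem_triangular C w)

/-- `𝔤` is generated by the `E_i`, `F_i` and `𝔥`. -/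
lemma mem_of_generators (C : CartanData R 𝔥) (S : LieSubalgebra ℂ (LieAlg C))
    (h : ∀ g, LieAlg.of C g ∈ S) (x : LieAlg C) : x ∈ S := by
  let f : FreeGen R 𝔥 →ₗ⁅ℂ⁆ S := FreeLieAlgebra.lift ℂ fun g => ⟨LieAlg.of C g, h g⟩
  let q : FreeGen R 𝔥 →ₗ⁅ℂ⁆ LieAlg C :=
    { (LieSubmodule.Quotient.mk' (relIdeal C) : FreeGen R 𝔥 →ₗ[ℂ] LieAlg C) with
      map_lie' := fun {_ _} => rfl }
  -- The quotient map from the free Lie algebra factors through `S`, since the two maps agree on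
  -- generators.
  have hf : S.incl.comp f = q := FreeLieAlgebra.hom_ext fun g => by
    rw [LieHom.comp_apply, FreeLieAlgebra.lift_of_apply]
    rfl
  obtain ⟨y, rfl⟩ := LieSubmodule.Quotient.surjective_mk' (relIdeal C) x
  have h1 : LieSubmodule.Quotient.mk' (relIdeal C) y = S.incl (f y) :=
    (DFunLike.congr_fun hf y).symm
  rw [h1]
  exact (f y).2

lemma triangular_eq_top (C : CartanData R 𝔥) : triangular C = ⊤ := by
  -- The elements whose `ad` preserves the triangular span form a subalgebra containing the
  -- generators, hence everything. The span is therefore closed under brackets, and it contains the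
  -- generators itself.
  let N : LieSubalgebra ℂ (LieAlg C) :=
    { carrier := {x | ∀ y ∈ triangular C, ⁅x, y⁆ ∈ triangular C}
      zero_mem' := by intro y _; simp
      add_mem' := by intro a b ha hb y hy; rw [add_lie]; exact add_mem (ha y hy) (hb y hy)
      smul_mem' := by intro c a ha y hy; rw [smul_lie]; exact Submodule.smul_mem _ _ (ha y hy)
      lie_mem' := by
        intro a b ha hb y hy
        rw [lie_lie]
        exact sub_mem (ha _ (hb _ hy)) (hb _ (ha _ hy)) }
  have hN : ∀ x, x ∈ N := mem_of_generators C N (by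
    rintro (i | i | h) y hy
    exacts [lie_E_mem_triangular C i hy, lie_F_mem_triangular C i hy, lie_H_mem_triangular C h hy])
  let S : LieSubalgebra ℂ (LieAlg C) :=
    { triangular C with lie_mem' := fun {a b} _ hb => hN a b hb }
  exact eq_top_iff.mpr fun x _ => mem_of_generators C S (by
    rintro (i | i | h)
    exacts [monE_mem_triangular C [i], monF_mem_triangular C [i], H_mem_triangular C h]) x

/-! ### The components in `𝔫` -/

lemma verma_of (C : CartanData R 𝔥) (g : Gen R 𝔥) : verma C (LieAlg.of C g) = actGen C g :=
  FreeLieAlgebra.lift_of_apply (R := ℂ) (actGen C) g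

lemma nComponent_apply (C : CartanData R 𝔥) (x : LieAlg C) :
    nComponent C x = verma C x (Finsupp.single [] 1) := rfl

lemma verma_lie_apply (C : CartanData R 𝔥) (x y : LieAlg C) (v : Words R) :
    verma C ⁅x, y⁆ v = verma C x (verma C y v) - verma C y (verma C x v) := by
  rw [LieHom.map_lie, end_lie]

lemma nComponent_H (C : CartanData R 𝔥) (h : 𝔥) : nComponent C (LieAlg.of C (.H h)) = 0 := by
  simp [nComponent_apply, verma_of, actGen]

lemma nComponent_monE (C : CartanData R 𝔥) (w : List (Fin R)) : nComponent C (monE C w) = 0 := by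
  have h1 : ∀ j, verma C (LieAlg.of C (.E j)) (Finsupp.single [] 1) = 0 := fun j => by
    simp [verma_of, actGen, wordE]
  refine mon_induction (fun j => LieAlg.of C (.E j)) (P := fun _ x => nComponent C x = 0)
    ?_ ?_ ?_ w
  · simp
  · exact h1
  · intro j w _ ih
    rw [nComponent_apply, verma_lie_apply, ← nComponent_apply, ih, h1]
    simp

/-- In highest weight `0`, `E_i F_j · 1 = δ_{ij} H_i · 1 = 0`, so the `E`s kill words of length one
as well as the vector `1`. -/
lemma verma_monE_single (C : CartanData R 𝔥) (w : List (Fin R)) (j : Fin R) :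
    verma C (monE C w) (Finsupp.single [j] 1) = 0 := by
  have h1 : ∀ i, verma C (LieAlg.of C (.E i)) (Finsupp.single [j] 1) = 0 := fun i => by
    simp [verma_of, actGen, wordE]
  refine mon_induction (fun j => LieAlg.of C (.E j))
    (P := fun _ x => verma C x (Finsupp.single [j] 1) = 0) ?_ ?_ ?_ w
  · simp
  · exact h1
  · intro j w _ ih
    rw [verma_lie_apply, ih, h1]
    simp

lemma verma_monF_mem (C : CartanData R 𝔥) (w : List (Fin R)) :
    ∀ (n : ℕ), ∀ v ∈ ofLength R (· = n), verma C (monF C w) v ∈ ofLength R (· = n + w.length) := by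
  have h1 : ∀ (j : Fin R) (n : ℕ), ∀ v ∈ ofLength R (· = n),
      verma C (LieAlg.of C (.F j)) v ∈ ofLength R (· = n + 1) := by
    intro j n v hv
    rw [verma_of]
    change v ∈ (ofLength R (· = n + 1)).comap (actF j)
    rw [ofLength_eq_span] at hv
    refine Submodule.span_le.mpr ?_ hv
    rintro _ ⟨w, hw, rfl⟩
    have hw : w.length = n := hw
    simp only [SetLike.mem_coe, Submodule.mem_comap, actF_single]
    exact single_mem_ofLength (by simp [hw]) 1
  refine mon_induction (fun j => LieAlg.of C (.F j))
    (P := fun w x => ∀ (n : ℕ), ∀ v ∈ ofLength R (· = n),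
      verma C x v ∈ ofLength R (· = n + w.length)) ?_ ?_ ?_ w
  · intro n v _; simp
  · intro j n v hv; exact h1 j n v hv
  · intro j w _ ih n v hv
    rw [verma_lie_apply, List.length_cons]
    refine sub_mem ?_ ?_
    · rw [← add_assoc]; exact h1 j _ _ (ih n v hv)
    · rw [add_comm w.length, ← add_assoc]; exact ih _ _ (h1 j n v hv)

lemma nComponent_monF_mem (C : CartanData R 𝔥) (w : List (Fin R)) :
    nComponent C (monF C w) ∈ ofLength R (· = w.length) := by
  have h := verma_monF_mem C w 0 (Finsupp.single [] 1) (single_mem_ofLength (by simp) 1)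
  rwa [zero_add] at h

/-- Right multiplication by a letter. -/
def mulRight (j : Fin R) : Module.End ℂ (Words R) := Finsupp.lmapDomain ℂ ℂ (· ++ [j])

/-- Left and right multiplications commute. Consequently an element of `𝔫` sends `F_j · 1` to its
own word expansion followed by `F_j`. -/
lemma verma_monF_mulRight (C : CartanData R 𝔥) (j : Fin R) (w : List (Fin R)) (v : Words R) :
    verma C (monF C w) (mulRight j v) = mulRight j (verma C (monF C w) v) := by
  have h1 : ∀ (i : Fin R) (v : Words R), verma C (LieAlg.of C (.F i)) (mulRight j v) =
      mulRight j (verma C (LieAlg.of C (.F i)) v) := by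
    intro i v
    rw [verma_of]
    induction v using Finsupp.induction_linear with
    | zero => simp
    | add u v hu hv => simp only [map_add, hu, hv]
    | single w c => simp [actGen, mulRight]
  refine mon_induction (fun j => LieAlg.of C (.F j))
    (P := fun _ x => ∀ v, verma C x (mulRight j v) = mulRight j (verma C x v)) ?_ ?_ ?_ w v
  · simp
  · exact h1
  · intro i w _ ih v
    rw [verma_lie_apply, verma_lie_apply, h1, ih, h1, ih, map_sub]

/-- Only the existence of the splitting is needed; directness plays no role. -/
lemma exists_triangular (C : CartanData R 𝔥) (x : LieAlg C) :
    ∃ a ∈ Submodule.span ℂ (Set.range (monF C)), ∃ h, ∃ b ∈ Submodule.span ℂ (Set.range (monE C)),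
      x = a + LieAlg.of C (.H h) + b := by
  have hx : x ∈ triangular C := by rw [triangular_eq_top]; trivial
  rw [triangular, Submodule.span_union, Submodule.span_union] at hx
  obtain ⟨y, hy, b, hb, rfl⟩ := Submodule.mem_sup.mp hx
  obtain ⟨a, ha, z, hz, rfl⟩ := Submodule.mem_sup.mp hy
  obtain ⟨h, rfl⟩ : ∃ h, LieAlg.of C (.H h) = z := by
    clear hx hy
    induction hz using Submodule.span_induction with
    | mem x hx => exact hx
    | zero => exact ⟨0, by simpa using H_smul C 0 0⟩
    | add x y _ _ hx hy =>
      obtain ⟨h, rfl⟩ := hx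
      obtain ⟨h', rfl⟩ := hy
      exact ⟨h + h', H_add C h h'⟩
    | smul c x _ hx =>
      obtain ⟨h, rfl⟩ := hx
      exact ⟨c • h, H_smul C c h⟩
  exact ⟨a, ha, h, b, hb, rfl⟩

/-- An element that normalizes every line `ℂ F_j` has an `𝔫`-component of degree at most one. -/
lemma nComponent_mem_of_lie_F (C : CartanData R 𝔥) (x : LieAlg C)
    (hx : ∀ j, ∃ c : ℂ, ⁅x, LieAlg.of C (.F j)⁆ = c • LieAlg.of C (.F j)) :
    nComponent C x ∈ ofLength R (· ≤ 1) := by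
  obtain ⟨a, ha, h, b, hb, rfl⟩ := exists_triangular C x
  have hb0 : nComponent C b = 0 := by
    refine (Submodule.span_le (p := LinearMap.ker (nComponent C))).mpr ?_ hb
    rintro _ ⟨w, rfl⟩
    exact nComponent_monE C w
  have hbj : ∀ j, verma C b (Finsupp.single [j] 1) = 0 := fun j => by
    refine (Submodule.span_le (p := LinearMap.ker ((LinearMap.applyₗ (Finsupp.single [j] 1)).comp
      (verma C : LieAlg C →ₗ[ℂ] Module.End ℂ (Words R))))).mpr ?_ hb
    rintro _ ⟨w, rfl⟩
    exact verma_monE_single C w j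
  have haj : ∀ j, verma C a (Finsupp.single [j] 1) = mulRight j (nComponent C a) := fun j => by
    have h1 : (Finsupp.single [j] 1 : Words R) = mulRight j (Finsupp.single [] 1) := by
      simp [mulRight]
    refine (Submodule.span_le (p := LinearMap.eqLocus
      ((LinearMap.applyₗ (Finsupp.single [j] 1)).comp
        (verma C : LieAlg C →ₗ[ℂ] Module.End ℂ (Words R)))
      (mulRight j ∘ₗ nComponent C))).mpr ?_ ha
    rintro _ ⟨w, rfl⟩
    change verma C (monF C w) (Finsupp.single [j] 1) = mulRight j (nComponent C (monF C w))
    rw [h1, verma_monF_mulRight]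
    rfl
  rw [map_add, map_add, nComponent_H, hb0, add_zero, add_zero]
  -- The main argument needs a letter `j` other than a given one. With at most one letter, brackets
  -- of length at least two are zero.
  by_cases hR : Subsingleton (Fin R)
  · refine (Submodule.span_le (p := (ofLength R (· ≤ 1)).comap (nComponent C))).mpr ?_ ha
    rintro _ ⟨w, rfl⟩
    rw [SetLike.mem_coe, Submodule.mem_comap]
    by_cases hw : 2 ≤ w.length
    · rw [monF, mon_eq_zero_of_subsingleton _ w hw, map_zero]
      exact zero_mem _
    · exact ofLength_mono (fun n hn => by omega) (nComponent_monF_mem C w)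
  · rw [not_subsingleton_iff_nontrivial] at hR
    rw [ofLength, Finsupp.mem_supported']
    intro w hw
    cases w with
    | nil => simp at hw
    | cons i w =>
      cases w with
      | nil => simp at hw
      | cons k w =>
      obtain ⟨j, hj⟩ := exists_ne i
      obtain ⟨c, hc⟩ := hx j
      have h2 := congrArg (nComponent C) hc
      have hF : verma C (LieAlg.of C (.F j)) (Finsupp.single [] 1) = Finsupp.single [j] 1 := by
        simp [verma_of, actGen]
      rw [nComponent_apply, verma_lie_apply, hF, map_smul] at h2
      simp only [map_add, LinearMap.add_apply, hbj, haj, ← nComponent_apply, nComponent_H, hb0] at h2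
      -- Apply `[x, F_j] = c F_j` to `1` and compare coefficients of the word `i k w j`, where `j ≠
      -- i`. The term `a F_j` gives the coefficient of `i k w` in `a`; the words of `F_j a` begin
      -- with `j`, and all other terms have length one.
      have h3 := DFunLike.congr_fun h2 (i :: k :: w ++ [j])
      have e1 : mulRight j (nComponent C a) (i :: k :: w ++ [j]) = nComponent C a (i :: k :: w) :=
        Finsupp.mapDomain_apply (List.append_left_injective [j]) _ _
      have e2 : verma C (LieAlg.of C (.F j)) (nComponent C a) (i :: k :: w ++ [j]) = 0 := by
        rw [verma_of]
        refine Finsupp.mapDomain_of_notMem_range _ _ ?_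
        rintro ⟨l, hl⟩
        exact hj (List.cons.inj hl).1
      have e3 : verma C (LieAlg.of C (.H h)) (Finsupp.single [j] 1) (i :: k :: w ++ [j]) = 0 := by
        simp [verma_of, actGen]
      have e4 : nComponent C (LieAlg.of C (.F j)) (i :: k :: w ++ [j]) = 0 := by
        rw [nComponent_apply, hF]
        simp
      simpa only [Finsupp.add_apply, Finsupp.sub_apply, Finsupp.smul_apply, map_zero,
        Finsupp.zero_apply, add_zero, e1, e2, e3, e4, sub_zero, smul_zero] using h3

variable {C : CartanData R 𝔥}

/-! ### Averages over a diagram automorphism -/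

namespace DiagramAut

/-- A diagram automorphism, as a linear map. -/
def toEnd (σ : DiagramAut C) : Module.End ℂ (LieAlg C) := (σ.aut.toLieHom : LieAlg C →ₗ[ℂ] LieAlg C)

/-- The sum of the first `T` powers of a diagram automorphism. -/
def trace (σ : DiagramAut C) (T : ℕ) : Module.End ℂ (LieAlg C) := ∑ k ∈ Finset.range T, σ.toEnd ^ k

variable (σ : DiagramAut C) {T : ℕ}

lemma toEnd_apply (x : LieAlg C) : σ.toEnd x = σ.aut x := rfl

lemma pow_succ_apply (k : ℕ) (x : LieAlg C) : (σ.toEnd ^ (k + 1)) x = σ.aut ((σ.toEnd ^ k) x) := by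
  rw [pow_succ', Module.End.mul_apply, toEnd_apply]

lemma trace_apply (x : LieAlg C) : σ.trace T x = ∑ k ∈ Finset.range T, (σ.toEnd ^ k) x := by
  simp [trace]

lemma pow_lie (k : ℕ) (x y : LieAlg C) :
    (σ.toEnd ^ k) ⁅x, y⁆ = ⁅(σ.toEnd ^ k) x, (σ.toEnd ^ k) y⁆ := by
  induction k with
  | zero => simp
  | succ k ih => rw [pow_succ_apply, ih, LieEquiv.map_lie, pow_succ_apply, pow_succ_apply]

lemma pow_of_fixed (k : ℕ) {x : LieAlg C} (hx : σ.aut x = x) : (σ.toEnd ^ k) x = x := by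
  induction k with
  | zero => simp
  | succ k ih => rw [pow_succ_apply, ih, hx]

lemma trace_of_fixed {x : LieAlg C} (hx : σ.aut x = x) : σ.trace T x = (T : ℂ) • x := by
  rw [trace_apply, Finset.sum_congr rfl fun k _ => σ.pow_of_fixed k hx]
  simp [Nat.cast_smul_eq_nsmul]

/-- The periodicity is required of `x` alone: off the span of the coroots the permutation does not
control `σ` on `𝔥`, so `σ` itself need not have order dividing `T`. -/
lemma aut_trace {x : LieAlg C} (hx : (σ.toEnd ^ T) x = x) :
    σ.aut (σ.trace T x) = σ.trace T x := by
  rw [trace_apply, map_sum]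
  simp only [← pow_succ_apply]
  have h := Finset.sum_range_succ' (fun k => (σ.toEnd ^ k) x) T
  rw [Finset.sum_range_succ, hx, pow_zero, Module.End.one_apply] at h
  exact (add_right_cancel h).symm

/-- The projection formula: a fixed element may be moved in and out of the average. -/
lemma trace_lie {x y : LieAlg C} (hy : σ.aut y = y) : ⁅σ.trace T x, y⁆ = σ.trace T ⁅x, y⁆ := by
  rw [trace_apply, trace_apply, sum_lie]
  exact Finset.sum_congr rfl fun k _ => by rw [pow_lie, σ.pow_of_fixed k hy]

lemma pow_F (k : ℕ) (j : Fin R) :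
    (σ.toEnd ^ k) (LieAlg.of C (.F j)) = LieAlg.of C (.F ((σ.perm ^ k) j)) := by
  induction k with
  | zero => simp
  | succ k ih => rw [pow_succ_apply, ih, σ.map_F, pow_succ', Equiv.Perm.mul_apply]

lemma pow_E (k : ℕ) (j : Fin R) :
    (σ.toEnd ^ k) (LieAlg.of C (.E j)) = LieAlg.of C (.E ((σ.perm ^ k) j)) := by
  induction k with
  | zero => simp
  | succ k ih => rw [pow_succ_apply, ih, σ.map_E, pow_succ', Equiv.Perm.mul_apply]

lemma pow_mon (k : ℕ) (g : Fin R → LieAlg C)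
    (hg : ∀ j, (σ.toEnd ^ k) (g j) = g ((σ.perm ^ k) j)) (w : List (Fin R)) :
    (σ.toEnd ^ k) (mon g w) = mon g (w.map (σ.perm ^ k)) := by
  let f : LieAlg C →ₗ⁅ℂ⁆ LieAlg C := { σ.toEnd ^ k with map_lie' := σ.pow_lie k _ _ }
  have h := map_mon f g w
  have h1 : (fun j => f (g j)) = fun j => g ((σ.perm ^ k) j) := funext hg
  rw [h1, mon_comp g ⇑(σ.perm ^ k)] at h
  exact h

lemma pow_monF (k : ℕ) (w : List (Fin R)) :
    (σ.toEnd ^ k) (monF C w) = monF C (w.map (σ.perm ^ k)) := σ.pow_mon k _ (σ.pow_F k) w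

lemma pow_monE (k : ℕ) (w : List (Fin R)) :
    (σ.toEnd ^ k) (monE C w) = monE C (w.map (σ.perm ^ k)) := σ.pow_mon k _ (σ.pow_E k) w

lemma aut_trace_monF (hT : σ.perm ^ T = 1) (w : List (Fin R)) :
    σ.aut (σ.trace T (monF C w)) = σ.trace T (monF C w) :=
  σ.aut_trace (by rw [pow_monF, hT]; simp)

lemma aut_trace_monE (hT : σ.perm ^ T = 1) (w : List (Fin R)) :
    σ.aut (σ.trace T (monE C w)) = σ.trace T (monE C w) :=
  σ.aut_trace (by rw [pow_monE, hT]; simp)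

/-- The trace of an element lies in every subspace that contains all of its conjugates. -/
lemma trace_mem (S : Submodule ℂ (LieAlg C)) {x : LieAlg C} (h : ∀ k, (σ.toEnd ^ k) x ∈ S) :
    σ.trace T x ∈ S := by
  rw [trace_apply]
  exact sum_mem fun k _ => h k

lemma nComponent_trace_monF_mem (w : List (Fin R)) :
    nComponent C (σ.trace T (monF C w)) ∈ ofLength R (· = w.length) :=
  σ.trace_mem ((ofLength R (· = w.length)).comap (nComponent C)) fun k => by
    rw [Submodule.mem_comap, pow_monF]
    simpa using nComponent_monF_mem C (w.map (σ.perm ^ k))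

lemma nComponent_trace_monE (w : List (Fin R)) : nComponent C (σ.trace T (monE C w)) = 0 :=
  σ.trace_mem (LinearMap.ker (nComponent C)) fun k => by
    rw [pow_monE]
    exact nComponent_monE C _

lemma nComponent_phi_trace_monE_mem (w : List (Fin R)) :
    nComponent C (phi C (σ.trace T (monE C w))) ∈ ofLength R (· = w.length) :=
  σ.trace_mem ((ofLength R (· = w.length)).comap (nComponent C ∘ₗ phi C)) fun k => by
    rw [Submodule.mem_comap, pow_monE, LinearMap.comp_apply, phi_monE, map_neg, map_smul]
    have h := nComponent_monF_mem C (w.map (σ.perm ^ k))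
    rw [List.length_map] at h
    exact neg_mem (Submodule.smul_mem _ _ h)

lemma nComponent_phi_trace_monF (w : List (Fin R)) :
    nComponent C (phi C (σ.trace T (monF C w))) = 0 :=
  σ.trace_mem (LinearMap.ker (nComponent C ∘ₗ phi C)) fun k => by
    rw [pow_monF, LinearMap.mem_ker, LinearMap.comp_apply, phi_monF, map_neg, map_smul,
      nComponent_monE]
    simp

/-- `σ` is prescribed on `𝔥` only at the coroots. Instead of locating `σ^k h` in `𝔥`, one retains
the property of `h` that automorphisms permuting the lines `ℂ F_j` preserve. -/
lemma pow_H_lie_F (k : ℕ) (h : 𝔥) (j : Fin R) : ∃ c : ℂ,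
    ⁅(σ.toEnd ^ k) (LieAlg.of C (.H h)), LieAlg.of C (.F j)⁆ = c • LieAlg.of C (.F j) := by
  have hj : LieAlg.of C (.F j) = (σ.toEnd ^ k) (LieAlg.of C (.F ((σ.perm ^ k).symm j))) := by
    rw [pow_F, Equiv.apply_symm_apply]
  refine ⟨-C.α ((σ.perm ^ k).symm j) h, ?_⟩
  rw [hj, ← pow_lie, lie_H_F, map_neg, map_smul, neg_smul]

lemma pow_H_lie_E (k : ℕ) (h : 𝔥) (j : Fin R) : ∃ c : ℂ,
    ⁅(σ.toEnd ^ k) (LieAlg.of C (.H h)), LieAlg.of C (.E j)⁆ = c • LieAlg.of C (.E j) := by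
  have hj : LieAlg.of C (.E j) = (σ.toEnd ^ k) (LieAlg.of C (.E ((σ.perm ^ k).symm j))) := by
    rw [pow_E, Equiv.apply_symm_apply]
  refine ⟨C.α ((σ.perm ^ k).symm j) h, ?_⟩
  rw [hj, ← pow_lie, lie_H_E, map_smul]

lemma nComponent_trace_H_mem (h : 𝔥) :
    nComponent C (σ.trace T (LieAlg.of C (.H h))) ∈ ofLength R (· ≤ 1) :=
  σ.trace_mem ((ofLength R (· ≤ 1)).comap (nComponent C)) fun k =>
    nComponent_mem_of_lie_F C _ (σ.pow_H_lie_F k h)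

lemma nComponent_phi_trace_H_mem (h : 𝔥) :
    nComponent C (phi C (σ.trace T (LieAlg.of C (.H h)))) ∈ ofLength R (· ≤ 1) :=
  σ.trace_mem ((ofLength R (· ≤ 1)).comap (nComponent C ∘ₗ phi C)) fun k =>
    nComponent_mem_of_lie_F C _ fun j => by
      obtain ⟨c, hc⟩ := σ.pow_H_lie_E k h j
      refine ⟨-c, ?_⟩
      rw [← phi_E, ← neg_inj, ← phi_lie, hc, map_smul, neg_smul, neg_neg]

/-! ### Vanishing of `Ω` -/

/-- The form whose skew-symmetrization is `Ω`. -/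
def halfOmega (C : CartanData R 𝔥) (σ : Equiv.Perm (Fin R)) (T : ℕ) [NeZero T] (ω : ℂ)
    (ι : Fin r → Fin R) : LieAlg C →ₗ[ℂ] LieAlg C →ₗ[ℂ] ℂ :=
  (symGeom C T ω σ ι).compl₁₂ (nComponent C ∘ₗ phi C) (nComponent C)

lemma halfOmega_apply [NeZero T] (ω : ℂ) (ι : Fin r → Fin R) (x y : LieAlg C) :
    halfOmega C σ.perm T ω ι x y =
      symGeom C T ω σ.perm ι (nComponent C (phi C x)) (nComponent C y) := rfl

lemma Omega_apply [NeZero T] (ω : ℂ) (ι : Fin r → Fin R) (x y : σ.fixed) :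
    σ.Omega T ω ι x y = halfOmega C σ.perm T ω ι x y - halfOmega C σ.perm T ω ι y x := rfl

/-- A functional that vanishes on the brackets of traces of simple root vectors vanishes on the
invariants in the span of the coroots. -/
lemma apply_trace_eq_zero (hT : σ.perm ^ T = 1) (hT0 : T ≠ 0) (β : LieAlg C →ₗ[ℂ] ℂ)
    (hβ : ∀ j, β ⁅σ.trace T (LieAlg.of C (.E j)), σ.trace T (LieAlg.of C (.F j))⁆ = 0)
    {z : LieAlg C} (hz : z ∈ lowerPart C 0) : β (σ.trace T z) = 0 := by
  refine (Submodule.span_le (p := LinearMap.ker (β ∘ₗ σ.trace T))).mpr ?_ hz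
  rintro _ ⟨j, rfl⟩
  have h := hβ j
  -- The bracket of the two averages is the average of `[E_j, ∑_k σ^k F_j]`, which is `H_j` times
  -- the number of `k < T` with `σ^k j = j`.
  rw [σ.trace_lie (y := σ.trace T (LieAlg.of C (.F j))) (σ.aut_trace_monF hT [j])] at h
  have h1 : ⁅LieAlg.of C (.E j), σ.trace T (LieAlg.of C (.F j))⁆ =
      (((Finset.range T).filter fun k => j = (σ.perm ^ k) j).card : ℂ) •
        LieAlg.of C (.H (C.coroot j)) := by
    rw [trace_apply, lie_sum, Nat.cast_smul_eq_nsmul, ← Finset.sum_const, Finset.sum_filter]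
    refine Finset.sum_congr rfl fun k _ => ?_
    rw [pow_F, lie_E_F]
    split_ifs with hk
    · rw [← hk]
    · rfl
  -- The exponent `k = 0` always counts, so the multiplicity can be cancelled.
  have h2 : ((Finset.range T).filter fun k => j = (σ.perm ^ k) j).card ≠ 0 :=
    Finset.card_ne_zero.mpr ⟨0, by simpa using Nat.pos_of_ne_zero hT0⟩
  rw [h1, map_smul, map_smul, smul_eq_mul] at h
  exact (mul_eq_zero.mp h).resolve_left (Nat.cast_ne_zero.mpr h2)

/-- Different lengths and length at most one vanish for degree reasons. Otherwise the value is `β`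
of an average over the span of the coroots, which is governed by the degree one values. -/
lemma halfOmega_trace_eq_zero [NeZero T] (hT : σ.perm ^ T = 1) (ω : ℂ) (ι : Fin r → Fin R)
    (hι : ∀ j, ∃! i, σ.perm.SameCycle (ι i) j) (β : LieAlg C →ₗ[ℂ] ℂ)
    (hβ : ∀ x y, σ.aut x = x → σ.aut y = y →
      halfOmega C σ.perm T ω ι x y - halfOmega C σ.perm T ω ι y x = β ⁅x, y⁆)
    (w w' : List (Fin R)) :
    halfOmega C σ.perm T ω ι (σ.trace T (monE C w)) (σ.trace T (monF C w')) = 0 := by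
  have key : ∀ w w' : List (Fin R),
      halfOmega C σ.perm T ω ι (σ.trace T (monE C w)) (σ.trace T (monF C w')) =
        β ⁅σ.trace T (monE C w), σ.trace T (monF C w')⁆ := by
    intro w w'
    -- The transposed half of `Ω` drops out, because brackets of `E`s have no component in `𝔫`.
    rw [← hβ _ _ (σ.aut_trace_monE hT w) (σ.aut_trace_monF hT w'), σ.halfOmega_apply ω ι
      (σ.trace T (monF C w')), nComponent_trace_monE, map_zero, sub_zero]
  have short : ∀ w w' : List (Fin R), (w.length = w'.length → w.length ≤ 1) →
      halfOmega C σ.perm T ω ι (σ.trace T (monE C w)) (σ.trace T (monF C w')) = 0 :=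
    fun w w' h => symGeom_eq_zero_of_forall_ne C T ω σ.perm ι hι (fun n h1 h2 => by
      rw [h1]; exact h (h1.symm.trans h2)) (σ.nComponent_phi_trace_monE_mem w)
        (σ.nComponent_trace_monF_mem w')
  by_cases hw : w.length = w'.length ∧ w' ≠ []
  swap
  · refine short w w' fun h => ?_
    have : w' = [] := not_not.mp fun h' => hw ⟨h, h'⟩
    rw [h, this]
    simp
  -- Only one average is pulled out; the inner one keeps the degree of `w'`, so bracketing with
  -- `monE C w` ends in degree zero.
  rw [key, σ.trace_lie (σ.aut_trace_monF hT w')]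
  refine σ.apply_trace_eq_zero hT (NeZero.ne T) β (fun j => ?_) ?_
  · exact (key [j] [j]).symm.trans (short [j] [j] fun _ => le_rfl)
  · refine lie_monE_mem_lowerPart C w 0 _ ?_
    rw [zero_add]
    refine σ.trace_mem _ fun k => ?_
    have h := monF_mem_lowerPart C (w := w'.map (σ.perm ^ k)) (by simpa using hw.2)
    rwa [List.length_map, ← hw.1, ← pow_monF] at h

/-- Fixed elements need not have fixed triangular parts, so the parts are averaged. The averaged `𝔥`
parts are not known to be fixed either, so they are removed by degree without using `hβ`. -/
lemma halfOmega_eq_zero [NeZero T] (hT : σ.perm ^ T = 1) (ω : ℂ) (ι : Fin r → Fin R)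
    (hι : ∀ j, ∃! i, σ.perm.SameCycle (ι i) j) (β : LieAlg C →ₗ[ℂ] ℂ)
    (hβ : ∀ x y, σ.aut x = x → σ.aut y = y →
      halfOmega C σ.perm T ω ι x y - halfOmega C σ.perm T ω ι y x = β ⁅x, y⁆)
    {x y : LieAlg C} (hx : σ.aut x = x) (hy : σ.aut y = y) :
    halfOmega C σ.perm T ω ι x y = 0 := by
  have hT0 : (T : ℂ) ≠ 0 := Nat.cast_ne_zero.mpr (NeZero.ne T)
  have hxy : halfOmega C σ.perm T ω ι (σ.trace T x) (σ.trace T y) = 0 := by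
    obtain ⟨a, ha, h, b, hb, rfl⟩ := exists_triangular C x
    obtain ⟨a', ha', h', b', hb', rfl⟩ := exists_triangular C y
    have e1 : nComponent C (phi C (σ.trace T a)) = 0 := by
      refine (Submodule.span_le
        (p := LinearMap.ker (nComponent C ∘ₗ phi C ∘ₗ σ.trace T))).mpr ?_ ha
      rintro _ ⟨w, rfl⟩
      exact σ.nComponent_phi_trace_monF w
    have e2 : nComponent C (σ.trace T b') = 0 := by
      refine (Submodule.span_le (p := LinearMap.ker (nComponent C ∘ₗ σ.trace T))).mpr ?_ hb'
      rintro _ ⟨w, rfl⟩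
      exact σ.nComponent_trace_monE w
    have top : ∀ u : Words R, u ∈ ofLength R (fun _ => True) := fun u => by
      simp [ofLength]
    have e3 : ∀ v, symGeom C T ω σ.perm ι
        (nComponent C (phi C (σ.trace T (LieAlg.of C (.H h))))) v = 0 := fun v =>
      symGeom_eq_zero_of_forall_ne C T ω σ.perm ι hι (fun n h1 _ => h1)
        (σ.nComponent_phi_trace_H_mem h) (top v)
    have e4 : ∀ v, symGeom C T ω σ.perm ι v
        (nComponent C (σ.trace T (LieAlg.of C (.H h')))) = 0 := fun v =>
      symGeom_eq_zero_of_forall_ne C T ω σ.perm ι hι (fun n _ h1 => h1)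
        (top v) (σ.nComponent_trace_H_mem h')
    have e5 : halfOmega C σ.perm T ω ι (σ.trace T b) (σ.trace T a') = 0 := by
      clear hx hy e1
      induction hb, ha' using Submodule.span_induction₂ with
      | mem_mem x y hx hy =>
        obtain ⟨w, rfl⟩ := hx
        obtain ⟨w', rfl⟩ := hy
        exact σ.halfOmega_trace_eq_zero hT ω ι hι β hβ w w'
      | zero_left => simp
      | zero_right => simp
      | add_left x y z _ _ _ h1 h2 => simp [h1, h2]
      | add_right x y z _ _ _ h1 h2 => simp [h1, h2]
      | smul_left c x y _ _ h => simp [h]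
      | smul_right c x y _ _ h => simp [h]
    rw [halfOmega_apply] at e5 ⊢
    simp only [map_add, LinearMap.add_apply, e1, e2, e3, e4, e5, map_zero, LinearMap.zero_apply,
      add_zero]
  -- On fixed elements each average is multiplication by `T ≠ 0`.
  rw [σ.trace_of_fixed hx, σ.trace_of_fixed hy, map_smul, map_smul, LinearMap.smul_apply,
    smul_eq_zero_iff_right hT0, smul_eq_zero_iff_right hT0] at hxy
  exact hxy

lemma Omega_eq_zero_of_coboundary [NeZero T] (hT : σ.perm ^ T = 1) (ω : ℂ) (ι : Fin r → Fin R)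
    (hι : ∀ j, ∃! i, σ.perm.SameCycle (ι i) j) (α : σ.fixed →ₗ[ℂ] ℂ)
    (hα : ∀ x y, σ.Omega T ω ι x y = α ⁅x, y⁆) : σ.Omega T ω ι = 0 := by
  -- Extending the functional to all of `𝔤` lets it be composed with the averaging map, whose values
  -- are not all known to be fixed.
  obtain ⟨β, hβ⟩ := LinearMap.exists_extend (p := σ.fixed.toSubmodule) α
  have h : ∀ x y, σ.aut x = x → σ.aut y = y →
      halfOmega C σ.perm T ω ι x y - halfOmega C σ.perm T ω ι y x = β ⁅x, y⁆ := by
    intro x y hx hy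
    have h1 := hα ⟨x, hx⟩ ⟨y, hy⟩
    rw [Omega_apply, ← hβ] at h1
    exact h1
  refine LinearMap.ext fun x => LinearMap.ext fun y => ?_
  rw [Omega_apply, σ.halfOmega_eq_zero hT ω ι hι β h x.2 y.2,
    σ.halfOmega_eq_zero hT ω ι hι β h y.2 x.2, sub_zero]
  rfl

end DiagramAut
end CyclotomicOmega
end

theorem mainTheorem9 {R r : ℕ} {𝔥 : Type*} [AddCommGroup 𝔥] [Module ℂ 𝔥] [FiniteDimensional ℂ 𝔥]
    (C : CyclotomicOmega.CartanData R 𝔥) (σ : CyclotomicOmega.DiagramAut C)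
    (T : ℕ) [NeZero T] (hT : σ.perm ^ T = 1)
    (ω : ℂ) (hω : IsPrimitiveRoot ω T)
    (ι : Fin r → Fin R) (hι : ∀ j, ∃! i, σ.perm.SameCycle (ι i) j) :
    ((∃ α : σ.fixed →ₗ[ℂ] ℂ, ∀ x y, σ.Omega T ω ι x y = α ⁅x, y⁆) → σ.Omega T ω ι = 0) ∧
    ((∃ α : σ.fixedQuot →ₗ[ℂ] ℂ, ∀ x y : σ.fixed, σ.Omega T ω ι x y =
        α ⁅(LieSubmodule.Quotient.mk x : σ.fixedQuot), (LieSubmodule.Quotient.mk y : σ.fixedQuot)⁆) →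
      σ.Omega T ω ι = 0) := by
  refine ⟨fun ⟨α, hα⟩ => σ.Omega_eq_zero_of_coboundary hT ω ι hι α hα, fun ⟨α, hα⟩ => ?_⟩
  exact σ.Omega_eq_zero_of_coboundary hT ω ι hι
    (α ∘ₗ (LieSubmodule.Quotient.mk' σ.fixedKer : σ.fixed →ₗ[ℂ] σ.fixedQuot)) fun x y => hα x y
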